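/- Let $G$ be a compact group with normalized Haar measure $\mathrm{d}g$, and let $\{U_g\}$ and $\{V_g\}$ be two continuous unitary representations of $G$ on $\mathbb{C}^{d_{\rm in}}$ and $\mathbb{C}^{d_{\rm out}}$, with $d_{\rm in},d_{\rm out}\ge 1$. For a $d\times d$ unitary matrix $A$ write $|\Phi_A\rangle=(A\otimes I)|\Phi\rangle$ with $|\Phi\rangle=d^{-1/2}\sum_{n=1}^d|n\rangle\otimes|n\rangle$. A quantum operation is a completely positive, trace non-increasing linear map. For a family of positive operators $\sigma_g$ on $\mathbb{C}^{d_{\rm out}}\otimes\mathbb{C}^{d_{\rm out}}$ with $p_{\rm succ}=\int \mathrm{d}g\,\mathrm{Tr}[\sigma_g]>0$, define the conditional average fidelity $$F[\sigma]=\int \mathrm{d}g\;\frac{\mathrm{Tr}[\sigma_g]}{p_{\rm succ}}\;\Big\langle\Phi_{V_g}\Big|\,\frac{\sigma_g}{\mathrm{Tr}[\sigma_g]}\,\Big|\Phi_{V_g}\Big\rangle ,$$ where the $g$ with $\mathrm{Tr}[\sigma_g]=0$ contribute $0$. * $F^{\rm prob}_{\rm Bell}$ is the supremum of $F[\sigma]$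 over all $\sigma_g=\mathcal{M}(|\Phi_{U_g}\rangle\langle\Phi_{U_g}|)$, with $\mathcal{M}$ a quantum operation from operators on $\mathbb{C}^{d_{\rm in}}\otimes\mathbb{C}^{d_{\rm in}}$ to operators on $\mathbb{C}^{d_{\rm out}}\otimes\mathbb{C}^{d_{\rm out}}$ and $p_{\rm succ}>0$. * $F^{\rm prob}_{\rm gate}$ is the supremum of $F[\sigma]$ over all $\sigma_g=(\mathcal{Q}_g\otimes\mathcal{I})(|\Phi\rangle\langle\Phi|)$, where $|\Phi\rangle\in\mathbb{C}^{d_{\rm out}}\otimes\mathbb{C}^{d_{\rm out}}$, $\mathcal{Q}_g=\mathcal{B}\circ(U_g\cdot U_g^\dagger\otimes\mathcal{I}_k)\circ\mathcal{A}$, $\mathcal{A}$ is a quantum operation from operators on $\mathbb{C}^{d_{\rm out}}$ to operators on $\mathbb{C}^{d_{\rm in}}\otimes\mathbb{C}^k$, $\mathcal{B}$ is a quantum operation from operators on $\mathbb{C}^{d_{\rm in}}\otimes\mathbb{C}^k$ to operators on $\mathbb{C}^{d_{\rm out}}$, the memory dimension $k$ is an arbitrary finite number, and $p_{\rm succ}>0$.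 For a unitary representation $R$ let $\mathrm{Irr}(R)$ be the set of equivalence classes of irreducible representations contained in $R$; for a class $l$ let $U^{(l)}$ be a representative and $d_l$ its dimension. Let $m_l^{(j)}$ be the multiplicity of $U^{(l)}$ in $\{V_g\otimes\overline{U}{}^{(j)}_g\}$, where the bar is entrywise complex conjugation. Then both suprema are attained, $\mathrm{Irr}(U)$ is finite, and $$F^{\rm prob}_{\rm gate}=F^{\rm prob}_{\rm Bell}=\max_{l\in\mathrm{Irr}(V\otimes\overline U)}\left[\frac{1}{d_{\rm out}\,d_l}\sum_{j\in\mathrm{Irr}(U)}d_j\,m_l^{(j)}\right].$$ If $\{U_g\}$ is irreducible, then, with $m_l$ the multiplicity of $U^{(l)}$ in $\{V_g\otimes\overline U_g\}$, $$F^{\rm prob}_{\rm gate}=F^{\rm prob}_{\rm Bell}=\frac{d_{\rm in}}{d_{\rm out}}\,\max_{l\in\mathrm{Irr}(V\otimes\overline U)}\frac{m_l}{d_l}.$$ -/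

import Mathlib

open MeasureTheory Matrix
open scoped Kronecker ComplexOrder

namespace GateSim

noncomputable section

/-! ### Quantum operations on matrix algebras -/

/-- The map `Φ ⊗ id` on the operators of a bipartite system: `Φ` acts on the first factor and the
second factor, with basis `r`, is left alone. -/
def ampliate {a b : Type*} (Φ : Matrix a a ℂ →ₗ[ℂ] Matrix b b ℂ) (r : Type*) :
    Matrix (a × r) (a × r) ℂ →ₗ[ℂ] Matrix (b × r) (b × r) ℂ where
  toFun X := Matrix.of fun x y => Φ (Matrix.of fun i j => X (i, x.2) (j, y.2)) x.1 y.1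
  map_add' X Y := by
    ext x y
    have h : (Matrix.of fun i j => (X + Y) (i, x.2) (j, y.2)) =
        (Matrix.of fun i j => X (i, x.2) (j, y.2)) +
          (Matrix.of fun i j => Y (i, x.2) (j, y.2)) := rfl
    rw [Matrix.add_apply, Matrix.of_apply, h, map_add]
    rfl
  map_smul' c X := by
    ext x y
    have h : (Matrix.of fun i j => (c • X) (i, x.2) (j, y.2)) =
        c • (Matrix.of fun i j => X (i, x.2) (j, y.2)) := rfl
    rw [RingHom.id_apply, Matrix.smul_apply, Matrix.of_apply, h, map_smul]
    rfl

/-- Complete positivity: `Φ ⊗ id` preserves positivity for every finite-dimensional ancilla. -/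
def IsCompletelyPositive {a b : Type*} (Φ : Matrix a a ℂ →ₗ[ℂ] Matrix b b ℂ) : Prop :=
  ∀ (k : ℕ) (X : Matrix (a × Fin k) (a × Fin k) ℂ),
    X.PosSemidef → (ampliate Φ (Fin k) X).PosSemidef

/-- A quantum operation: a completely positive, trace non-increasing linear map. -/
def IsQuantumOperation {a b : Type*} [Fintype a] [Fintype b]
    (Φ : Matrix a a ℂ →ₗ[ℂ] Matrix b b ℂ) : Prop :=
  IsCompletelyPositive Φ ∧
    ∀ X : Matrix a a ℂ, X.PosSemidef → (Φ X).trace.re ≤ X.trace.re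

/-- The channel `X ↦ A X A†`. -/
def conjChannel {a : Type*} [Fintype a] (A : Matrix a a ℂ) :
    Matrix a a ℂ →ₗ[ℂ] Matrix a a ℂ where
  toFun X := A * X * Aᴴ
  map_add' X Y := by rw [Matrix.mul_add, Matrix.add_mul]
  map_smul' c X := by simp

/-! ### Bell states -/

/-- The canonical Bell state `∑ₙ |n⟩ ⊗ |n⟩ / √d`. -/
def bell (a : Type*) [Fintype a] [DecidableEq a] : a × a → ℂ :=
  fun x => if x.1 = x.2 then ((Real.sqrt (Fintype.card a))⁻¹ : ℝ) else 0

/-- The Bell state `|Φ_A⟩ = (A ⊗ I)|Φ⟩`. -/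
def bellOf {a : Type*} [Fintype a] [DecidableEq a] (A : Matrix a a ℂ) : a × a → ℂ :=
  (A ⊗ₖ (1 : Matrix a a ℂ)) *ᵥ bell a

/-- The rank-one operator `|ψ⟩⟨ψ|`. -/
def ketbra {a : Type*} (ψ : a → ℂ) : Matrix a a ℂ := vecMulVec ψ (star ψ)

/-- The fidelity `⟨ψ|ρ|ψ⟩`. -/
def fidelity {a : Type*} [Fintype a] (ψ : a → ℂ) (ρ : Matrix a a ℂ) : ℝ :=
  (star ψ ⬝ᵥ (ρ *ᵥ ψ)).re

/-! ### Optimal probabilistic fidelities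

`μ` is the distribution of the unknown group element. A probabilistic machine produces, for every
`g`, an unnormalized output state `σ g`; the success probability is `p(succ|g) = Tr (σ g)` and the
output state, given success, is `σ g / Tr (σ g)`. -/

/-- The total success probability `∫ p(succ|g) dg`. -/
def successProb {G c : Type*} [MeasurableSpace G] [Fintype c] (μ : Measure G)
    (σ : G → Matrix c c ℂ) : ℝ :=
  ∫ g, (σ g).trace.re ∂μ

/-- The average, over the conditional distribution `p(dg|succ) = p(succ|g) dg / p_succ`, of the
fidelity between the target `ψ g` and the output state `σ g / Tr (σ g)`. Elements `g` with
`p(succ|g) = 0` carry no weight. -/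
def conditionalFidelity {G c : Type*} [MeasurableSpace G] [Fintype c] (μ : Measure G)
    (σ : G → Matrix c c ℂ) (ψ : G → c → ℂ) : ℝ :=
  ∫ g, ((σ g).trace.re / successProb μ σ) *
    fidelity (ψ g) ((((σ g).trace.re)⁻¹ : ℝ) • σ g) ∂μ

/-- A representation of `G` by unitary matrices with index set `a`. -/
abbrev UnitaryRep (G : Type*) [Group G] (a : Type*) [Fintype a] [DecidableEq a] : Type _ :=
  G →* Matrix.unitaryGroup a ℂ

section Tasks

variable {G : Type*} [Group G] [MeasurableSpace G]
  {m n : Type*} [Fintype m] [DecidableEq m] [Fintype n] [DecidableEq n]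

/-- The fidelities of the Bell state conversion `|Φ_{U_g}⟩ → |Φ_{V_g}⟩` achieved by the
probabilistic machines, i.e. quantum operations `M`, acting jointly on both input systems, that
succeed with non-zero probability. -/
def bellFidelities (U : UnitaryRep G m) (V : UnitaryRep G n) (μ : Measure G) : Set ℝ :=
  {F | ∃ M : Matrix (m × m) (m × m) ℂ →ₗ[ℂ] Matrix (n × n) (n × n) ℂ,
    IsQuantumOperation M ∧
    0 < successProb μ (fun g => M (ketbra (bellOf (U g : Matrix m m ℂ)))) ∧
    F = conditionalFidelity μ (fun g => M (ketbra (bellOf (U g : Matrix m m ℂ))))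
      (fun g => bellOf (V g : Matrix n n ℂ))}

/-- The optimal fidelity of the probabilistic Bell state conversion. -/
def bellFidelity (U : UnitaryRep G m) (V : UnitaryRep G n) (μ : Measure G) : ℝ :=
  sSup (bellFidelities U V μ)

/-- A probabilistic network with one open slot: a quantum operation `pre` from the output-type
system (basis `n`) to the system acted on by the gate (basis `m`) and a memory of dimension `k`,
followed by the gate, followed by a quantum operation `post` on gate system and memory. -/
def networkMap {k : ℕ}
    (pre : Matrix n n ℂ →ₗ[ℂ] Matrix (m × Fin k) (m × Fin k) ℂ)
    (post : Matrix (m × Fin k) (m × Fin k) ℂ →ₗ[ℂ] Matrix n n ℂ)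
    (A : Matrix m m ℂ) : Matrix n n ℂ →ₗ[ℂ] Matrix n n ℂ :=
  post ∘ₗ ampliate (conjChannel A) (Fin k) ∘ₗ pre

/-- The (unnormalized) output state `(Q ⊗ I)(|Φ_out⟩⟨Φ_out|)`. -/
def networkOutput (Q : Matrix n n ℂ →ₗ[ℂ] Matrix n n ℂ) : Matrix (n × n) (n × n) ℂ :=
  ampliate Q n (ketbra (bell n))

/-- The (entanglement) fidelities of the gate simulation `U_g → V_g` achieved by the probabilistic
networks that use the gate `U_g` once and succeed with non-zero probability. -/
def gateFidelities (U : UnitaryRep G m) (V : UnitaryRep G n) (μ : Measure G) : Set ℝ :=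
  {F | ∃ (k : ℕ)
    (pre : Matrix n n ℂ →ₗ[ℂ] Matrix (m × Fin k) (m × Fin k) ℂ)
    (post : Matrix (m × Fin k) (m × Fin k) ℂ →ₗ[ℂ] Matrix n n ℂ),
    IsQuantumOperation pre ∧ IsQuantumOperation post ∧
    0 < successProb μ
      (fun g => networkOutput (networkMap pre post (U g : Matrix m m ℂ))) ∧
    F = conditionalFidelity μ
      (fun g => networkOutput (networkMap pre post (U g : Matrix m m ℂ)))
      (fun g => bellOf (V g : Matrix n n ℂ))}

/-- The optimal fidelity of the probabilistic gate simulation. -/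
def gateFidelity (U : UnitaryRep G m) (V : UnitaryRep G n) (μ : Measure G) : ℝ :=
  sSup (gateFidelities U V μ)

end Tasks

/-! ### Unitary representations, irreducible representations, multiplicities -/

section Reps

variable {G : Type*} [Group G]
  {m n : Type*} [Fintype m] [DecidableEq m] [Fintype n] [DecidableEq n]

/-- The complex conjugate representation (entrywise conjugation). -/
def conjRep (U : UnitaryRep G m) : UnitaryRep G m where
  toFun g := ⟨(U g : Matrix m m ℂ).map star, by
    have h1 := Matrix.mem_unitaryGroup_iff.mp (U g).2
    rw [Matrix.mem_unitaryGroup_iff]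
    have h2 := congrArg (fun X : Matrix m m ℂ => X.map (starRingEnd ℂ)) h1
    simp only [Matrix.map_mul] at h2
    rw [Matrix.map_one _ (map_zero _) (map_one _)] at h2
    exact h2⟩
  map_one' := by
    ext i j
    simp [Matrix.one_apply, apply_ite (starRingEnd ℂ)]
  map_mul' g h := by
    ext i j
    simp [Matrix.mul_apply]

/-- The tensor product representation. -/
def tensorRep (U : UnitaryRep G m) (V : UnitaryRep G n) : UnitaryRep G (m × n) where
  toFun g := ⟨(U g : Matrix m m ℂ) ⊗ₖ (V g : Matrix n n ℂ),
    Matrix.kronecker_mem_unitary (U g).2 (V g).2⟩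
  map_one' := by
    apply Subtype.ext
    simp
  map_mul' g h := by
    apply Subtype.ext
    simp [Matrix.mul_kronecker_mul]

/-- The underlying linear representation on `ℂ^m`. -/
def linearRep (U : UnitaryRep G m) : Representation ℂ G (m → ℂ) where
  toFun g := Matrix.toLinAlgEquiv' (U g : Matrix m m ℂ)
  map_one' := by simp
  map_mul' g h := by simp

/-- Irreducibility: the space is non-zero and has exactly the two trivial invariant subspaces. -/
def IsIrred (U : UnitaryRep G m) : Prop := (linearRep U).IsIrreducible

/-- `W ⊗ I_k` occurs in `R`: an isometry embeds it equivariantly into the space of `R`. -/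
def OccursTimes (W : UnitaryRep G m) (k : ℕ) (R : UnitaryRep G n) : Prop :=
  ∃ T : Matrix n (m × Fin k) ℂ, Tᴴ * T = 1 ∧
    ∀ g, (R g : Matrix n n ℂ) * T =
      T * ((W g : Matrix m m ℂ) ⊗ₖ (1 : Matrix (Fin k) (Fin k) ℂ))

/-- The multiplicity of an irreducible representation `W` in the representation `R`: the largest
`k` such that `W ⊗ I_k` occurs in `R`. -/
def multiplicity (W : UnitaryRep G m) (R : UnitaryRep G n) : ℕ :=
  sSup {k : ℕ | OccursTimes W k R}

end Reps

/-- An irreducible unitary matrix representation of `G`. -/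
structure IrredRep (G : Type*) [Group G] where
  /-- the dimension -/
  dim : ℕ
  /-- the representation -/
  rep : UnitaryRep G (Fin dim)
  irred : IsIrred rep

/-- Unitary equivalence of irreducible representations. -/
instance irredSetoid (G : Type*) [Group G] : Setoid (IrredRep G) where
  r W W' := ∃ T : Matrix (Fin W'.dim) (Fin W.dim) ℂ, Tᴴ * T = 1 ∧ T * Tᴴ = 1 ∧
    ∀ g, (W'.rep g : Matrix (Fin W'.dim) (Fin W'.dim) ℂ) * T =
      T * (W.rep g : Matrix (Fin W.dim) (Fin W.dim) ℂ)
  iseqv :=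
    { refl := fun W => ⟨1, by simp, by simp, fun g => by simp⟩
      symm := by
        rintro W W' ⟨T, h1, h2, h3⟩
        refine ⟨Tᴴ, by simpa using h2, by simpa using h1, fun g => ?_⟩
        calc (W.rep g : Matrix (Fin W.dim) (Fin W.dim) ℂ) * Tᴴ
            = Tᴴ * T * (W.rep g : Matrix (Fin W.dim) (Fin W.dim) ℂ) * Tᴴ := by
              rw [h1, Matrix.one_mul]
          _ = Tᴴ * ((W'.rep g : Matrix (Fin W'.dim) (Fin W'.dim) ℂ) * T) * Tᴴ := by
              rw [h3, Matrix.mul_assoc Tᴴ T]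
          _ = Tᴴ * (W'.rep g : Matrix (Fin W'.dim) (Fin W'.dim) ℂ) := by
              rw [Matrix.mul_assoc, Matrix.mul_assoc, h2, Matrix.mul_one]
      trans := by
        rintro W W' W'' ⟨T, h1, h2, h3⟩ ⟨S, k1, k2, k3⟩
        refine ⟨S * T, ?_, ?_, fun g => ?_⟩
        · rw [Matrix.conjTranspose_mul, Matrix.mul_assoc, ← Matrix.mul_assoc Sᴴ, k1,
            Matrix.one_mul, h1]
        · rw [Matrix.conjTranspose_mul, Matrix.mul_assoc, ← Matrix.mul_assoc T, h2,
            Matrix.one_mul, k2]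
        · rw [← Matrix.mul_assoc, k3, Matrix.mul_assoc, h3, ← Matrix.mul_assoc] }

/-- The equivalence classes of irreducible unitary representations of `G`. -/
abbrev IrredClass (G : Type*) [Group G] : Type _ := Quotient (irredSetoid G)

namespace IrredClass

variable {G : Type*} [Group G]

/-- The dimension `d_l` of the irreducible representation labelled by `l`. -/
def dim (l : IrredClass G) : ℕ := (Quotient.out l).dim

/-- The (chosen representative of the) irreducible representation labelled by `l`. -/
def rep (l : IrredClass G) : UnitaryRep G (Fin l.dim) := (Quotient.out l).rep

end IrredClass

/-- The irreducible representations contained in the decomposition of `R`, up to equivalence. -/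
def Irr {G n : Type*} [Group G] [Fintype n] [DecidableEq n] (R : UnitaryRep G n) :
    Set (IrredClass G) :=
  {l | 0 < multiplicity l.rep R}

end

end GateSim

/-! Every machine, converter or network, turns the black box into a mixture of pure states whose
unnormalized vectors have entries in the span of the matrix coefficients of `U` (`coeffSpace`):
Kraus operators act linearly, and the gate enters each Kraus branch once. Conversely every vector
`f` with entries in that span is, up to a nonzero scalar, the output of a machine with a single
Kraus branch, and a network can postselect teleportation to do the same. The conditional fidelity
ignores the overall scalar, so both tasks reduce to one problem: maximize `∫ |⟨V_g, f_g⟩|² / ∫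
‖f_g‖²` over such `f`, times the factor `1/d_out` from the Bell normalization. Mixtures cannot do
better than their best branch.

This problem is solved by Schur orthogonality. Expand `f` over `j ∈ Irr U` with coefficient matrices
`C_j` on `ℂⁿ ⊗ ℂ^{d_j}`. Parseval gives `∫ ‖f‖² = ∑ d_j⁻¹ ‖C_j‖²`. The overlap is `∑_j tr (C_j (V ⊗
j̄)(g)†)`; expanding each `V ⊗ j̄` into irreducibles `l` with embeddings `E_{jα}` and using Parseval
again gives `∑_l d_l⁻¹ ‖∑_{j,α} E_{jα}† C_j E_{jα}‖²`. Cauchy–Schwarz with weights `d_j` bounds the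
`l` term by `(∑_j d_j m_l^{(j)}) / d_l` times `∑_{j,α} d_j⁻¹ ‖E_{jα}† C_j E_{jα}‖²`, and compression
to orthogonal blocks does not increase the Frobenius norm (`integral_overlap_le`). Equality holds
for `C_j = d_j P_l`, with `P_l` the isotypic projection of `V ⊗ j̄` (`exists_integral_overlap_eq`).

The reduction is carried by `exists_kraus`, `exists_mixture_of_conversion`,
`exists_mixture_of_network`, `exists_conversion` and `exists_network`. -/

namespace GateSim

/-! ### Equivariant maps, Schur's lemma and existence of irreducible subrepresentations. -/

section Intertwiners

variable {G : Type*} [Group G]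
  {m n k : Type*} [Fintype m] [DecidableEq m] [Fintype n] [DecidableEq n]
  [Fintype k] [DecidableEq k]

/-- `A` is an equivariant map from the space of `W` to the space of `R`. -/
def Intertwines (W : UnitaryRep G m) (R : UnitaryRep G n) (A : Matrix n m ℂ) : Prop :=
  ∀ g, (R g : Matrix n n ℂ) * A = A * (W g : Matrix m m ℂ)

lemma coe_inv_rep (R : UnitaryRep G n) (g : G) :
    (R g⁻¹ : Matrix n n ℂ) = (R g : Matrix n n ℂ)ᴴ := by
  rw [map_inv]; rfl

lemma rep_mul_conjTranspose (R : UnitaryRep G n) (g : G) :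
    (R g : Matrix n n ℂ) * (R g : Matrix n n ℂ)ᴴ = 1 :=
  Matrix.mem_unitaryGroup_iff.mp (R g).2

lemma conjTranspose_mul_rep (R : UnitaryRep G n) (g : G) :
    (R g : Matrix n n ℂ)ᴴ * (R g : Matrix n n ℂ) = 1 :=
  Matrix.mem_unitaryGroup_iff'.mp (R g).2

lemma coe_rep_mul (R : UnitaryRep G n) (g h : G) :
    (R (g * h) : Matrix n n ℂ) = (R g : Matrix n n ℂ) * (R h : Matrix n n ℂ) := by
  rw [map_mul]; rfl

lemma linearRep_apply (R : UnitaryRep G n) (g : G) (v : n → ℂ) :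
    linearRep R g v = (R g : Matrix n n ℂ) *ᵥ v := by
  simp [linearRep]

namespace Intertwines

variable {W : UnitaryRep G m} {R : UnitaryRep G n} {S : UnitaryRep G k}
  {A : Matrix n m ℂ} {B : Matrix k n ℂ}

lemma conjTranspose (h : Intertwines W R A) : Intertwines R W Aᴴ := fun g => by
  have := congrArg Matrix.conjTranspose (h g⁻¹)
  rw [Matrix.conjTranspose_mul, Matrix.conjTranspose_mul, coe_inv_rep, coe_inv_rep,
    Matrix.conjTranspose_conjTranspose, Matrix.conjTranspose_conjTranspose] at this
  exact this.symm

lemma mul (hB : Intertwines R S B) (hA : Intertwines W R A) : Intertwines W S (B * A) :=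
  fun g => by rw [← Matrix.mul_assoc, hB g, Matrix.mul_assoc, hA g, Matrix.mul_assoc]

lemma smul (h : Intertwines W R A) (c : ℂ) : Intertwines W R (c • A) := fun g => by
  rw [Matrix.mul_smul, h g, Matrix.smul_mul]

end Intertwines

/-- Schur's lemma for endomorphisms. -/
lemma IsIrred.exists_eq_smul_one {W : UnitaryRep G m} (hW : IsIrred W) {A : Matrix m m ℂ}
    (hA : Intertwines W W A) : ∃ c : ℂ, A = c • 1 := by
  have : IsSimpleOrder (Subrepresentation (linearRep W)) := hW
  have : Nontrivial (m → ℂ) := by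
    by_contra h
    rw [not_nontrivial_iff_subsingleton] at h
    apply bot_ne_top (α := Subrepresentation (linearRep W))
    apply Subrepresentation.toSubmodule_injective
    exact Subsingleton.elim _ _
  obtain ⟨c, hc⟩ := Module.End.exists_eigenvalue (Matrix.toLin' A)
  -- An eigenspace of `A` is invariant because `A` commutes with `W`; being nonzero, it is the whole
  -- space.
  let p : Subrepresentation (linearRep W) :=
    { toSubmodule := Module.End.eigenspace (Matrix.toLin' A) c
      apply_mem_toSubmodule := fun g v hv => by
        rw [Module.End.mem_eigenspace_iff, Matrix.toLin'_apply] at hv ⊢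
        rw [linearRep_apply, Matrix.mulVec_mulVec, ← hA g, ← Matrix.mulVec_mulVec, hv,
          Matrix.mulVec_smul] }
  rcases eq_bot_or_eq_top p with h | h
  · exact absurd (congrArg Subrepresentation.toSubmodule h) hc
  · refine ⟨c, ?_⟩
    apply Matrix.toLin'.injective
    ext1 i
    ext1
    have : ∀ v, v ∈ p := fun v => by rw [h]; exact Submodule.mem_top
    have h2 := Module.End.mem_eigenspace_iff.mp (this (Pi.single i 1))
    simpa using h2

lemma IsIrred.nonempty {W : UnitaryRep G m} (hW : IsIrred W) : Nonempty m := by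
  have : IsSimpleOrder (Subrepresentation (linearRep W)) := hW
  by_contra h
  rw [not_nonempty_iff] at h
  apply bot_ne_top (α := Subrepresentation (linearRep W))
  apply Subrepresentation.toSubmodule_injective
  exact Subsingleton.elim _ _

/-- A nonzero equivariant map out of an irreducible representation is a multiple of an
isometry. -/
lemma IsIrred.exists_smul_isometry {W : UnitaryRep G m} (hW : IsIrred W) {R : UnitaryRep G n}
    {A : Matrix n m ℂ} (hA : Intertwines W R A) (h0 : A ≠ 0) :
    ∃ r : ℂ, r ≠ 0 ∧ (r • A)ᴴ * (r • A) = 1 := by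
  obtain ⟨c, hc⟩ := hW.exists_eq_smul_one (hA.conjTranspose.mul hA)
  have hc0 : c ≠ 0 := by
    rintro rfl
    rw [zero_smul, Matrix.conjTranspose_mul_self_eq_zero] at hc
    exact h0 hc
  obtain ⟨i⟩ := hW.nonempty
  -- The scalar `c` is a diagonal entry of `Aᴴ * A`, so it is real and nonnegative and `r = 1/√c`
  -- normalizes `A`.
  have hpos : 0 ≤ c := by
    have h1 : 0 ≤ (Aᴴ * A) i i := (Matrix.posSemidef_conjTranspose_mul_self A).diag_nonneg
    rw [hc] at h1
    simpa using h1
  obtain ⟨hre, him⟩ := Complex.nonneg_iff.mp hpos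
  have hcre : c = (c.re : ℂ) := by apply Complex.ext <;> simp [← him]
  have hre0 : c.re ≠ 0 := by
    intro h; apply hc0; rw [hcre, h]; simp
  refine ⟨((Real.sqrt c.re)⁻¹ : ℝ), ?_, ?_⟩
  · rw [Ne, Complex.ofReal_eq_zero, inv_eq_zero, Real.sqrt_eq_zero hre]
    exact hre0
  · rw [Matrix.conjTranspose_smul, Matrix.smul_mul, Matrix.mul_smul, hc, smul_smul, smul_smul]
    rw [hcre]
    have : (Real.sqrt c.re)⁻¹ * ((Real.sqrt c.re)⁻¹ * c.re) = 1 := by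
      rw [← mul_assoc, ← mul_inv, Real.mul_self_sqrt hre, inv_mul_cancel₀ hre0]
    have h2 := congrArg (fun x : ℝ => (x : ℂ)) this
    push_cast at h2
    simp only [Complex.star_def, Complex.ofReal_inv, map_inv₀, Complex.conj_ofReal,
      Complex.ofReal_re]
    rw [mul_assoc, h2, one_smul]

/-- Schur's lemma: irreducible representations with a nonzero equivariant map between them are
unitarily equivalent. -/
lemma IsIrred.exists_unitary {W : UnitaryRep G m} (hW : IsIrred W) {R : UnitaryRep G n}
    (hR : IsIrred R) {A : Matrix n m ℂ} (hA : Intertwines W R A) (h0 : A ≠ 0) :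
    ∃ T : Matrix n m ℂ, Tᴴ * T = 1 ∧ T * Tᴴ = 1 ∧ Intertwines W R T := by
  obtain ⟨r, hr, h1⟩ := hW.exists_smul_isometry hA h0
  have hT := hA.smul r
  refine ⟨r • A, h1, ?_, hT⟩
  -- With `T = r • A`, `T Tᴴ = c`; then `c T = T Tᴴ T = T` forces `c = 1`.
  obtain ⟨c, hc⟩ := hR.exists_eq_smul_one (hT.mul hT.conjTranspose)
  have h2 : (c - 1) • (r • A) = 0 := by
    rw [sub_smul, one_smul, sub_eq_zero]
    calc c • (r • A) = (c • (1 : Matrix n n ℂ)) * (r • A) := by rw [Matrix.smul_mul, Matrix.one_mul]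
      _ = (r • A) := by rw [← hc, Matrix.mul_assoc, h1, Matrix.mul_one]
  rcases smul_eq_zero.mp h2 with h3 | h3
  · rw [hc, sub_eq_zero.mp h3, one_smul]
  · exact absurd h3 (smul_ne_zero hr h0)

lemma IrredClass.irred (l : IrredClass G) : IsIrred l.rep := (Quotient.out l).irred

lemma IrredClass.dim_pos (l : IrredClass G) : 0 < l.dim :=
  Fin.pos_iff_nonempty.mpr l.irred.nonempty

/-- Schur's lemma in the form used throughout: between distinct classes every equivariant map
vanishes. -/
lemma IrredClass.eq_of_intertwines {l l' : IrredClass G} {A : Matrix (Fin l'.dim) (Fin l.dim) ℂ}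
    (hA : Intertwines l.rep l'.rep A) (h0 : A ≠ 0) : l = l' := by
  obtain ⟨T, h1, h2, h3⟩ := l.irred.exists_unitary l'.irred hA h0
  rw [← Quotient.out_eq l, ← Quotient.out_eq l']
  exact Quotient.sound ⟨T, h1, h2, h3⟩

-- The columns of `A` are an orthonormal basis of `p`, obtained by moving `p` into `EuclideanSpace`.
-- This turns invariant subspaces into matrix representations indexed by `Fin`.
omit [DecidableEq n] in
lemma exists_isometry_onto (p : Submodule ℂ (n → ℂ)) :
    ∃ A : Matrix n (Fin (Module.finrank ℂ p)) ℂ, Aᴴ * A = 1 ∧ (∀ w, A *ᵥ w ∈ p) ∧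
      ∀ v ∈ p, A *ᵥ (Aᴴ *ᵥ v) = v := by
  let e : EuclideanSpace ℂ n ≃ₗ[ℂ] (n → ℂ) := WithLp.linearEquiv 2 ℂ (n → ℂ)
  let q : Submodule ℂ (EuclideanSpace ℂ n) := p.comap e.toLinearMap
  have hq : Module.finrank ℂ q = Module.finrank ℂ p := by
    have : q.map e.toLinearMap = p := Submodule.map_comap_eq_of_surjective e.surjective p
    rw [← this]
    exact (LinearEquiv.finrank_map_eq e q).symm
  let b : OrthonormalBasis (Fin (Module.finrank ℂ p)) ℂ q :=
    (stdOrthonormalBasis ℂ q).reindex (finCongr hq)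
  have hb : ∀ i j, ∑ x, star ((b i : EuclideanSpace ℂ n) x) * (b j : EuclideanSpace ℂ n) x =
      if i = j then 1 else 0 := fun i j => by
    rw [← orthonormal_iff_ite.mp b.orthonormal i j, Submodule.coe_inner, PiLp.inner_apply]
    exact Finset.sum_congr rfl fun x _ => by rw [RCLike.inner_apply, mul_comm]; rfl
  refine ⟨Matrix.of fun x i => (b i : EuclideanSpace ℂ n) x, ?_, fun w => ?_, fun v hv => ?_⟩
  · ext i j
    rw [Matrix.mul_apply, Matrix.one_apply, ← hb i j]
    rfl
  · have h : (Matrix.of fun x i => (b i : EuclideanSpace ℂ n) x) *ᵥ w =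
        ∑ i, w i • e (b i : EuclideanSpace ℂ n) := by
      ext x
      simp only [Matrix.mulVec, dotProduct, Matrix.of_apply, Finset.sum_apply, Pi.smul_apply,
        smul_eq_mul]
      exact Finset.sum_congr rfl fun i _ => mul_comm _ _
    rw [h]
    exact Submodule.sum_mem _ fun i _ => Submodule.smul_mem _ _ (b i).2
  · let v' : q := ⟨e.symm v, by simpa [q] using hv⟩
    have h1 := congrArg (fun y : q => e (y : EuclideanSpace ℂ n)) (b.sum_repr' v')
    simp only [Submodule.coe_sum, Submodule.coe_smul, map_sum, map_smul] at h1
    have h2 : e (v' : EuclideanSpace ℂ n) = v := e.apply_symm_apply v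
    rw [h2] at h1
    conv_rhs => rw [← h1]
    ext x
    simp only [Matrix.mulVec, dotProduct, Matrix.of_apply, Finset.sum_apply, Pi.smul_apply,
      smul_eq_mul, Matrix.conjTranspose_apply]
    refine Finset.sum_congr rfl fun i _ => ?_
    rw [mul_comm]
    congr 1
    rw [Submodule.coe_inner, PiLp.inner_apply]
    exact Finset.sum_congr rfl fun x _ => by rw [RCLike.inner_apply, mul_comm]; rfl

/-- The restriction of `R` to the range of an isometry, when that range is invariant. -/
def compress (R : UnitaryRep G n) (A : Matrix n k ℂ) (hA : Aᴴ * A = 1)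
    (hR : ∀ g, A * (Aᴴ * ((R g : Matrix n n ℂ) * A)) = (R g : Matrix n n ℂ) * A) :
    UnitaryRep G k where
  toFun g := ⟨Aᴴ * ((R g : Matrix n n ℂ) * A), by
    -- Unitarity needs the range of `A` to be invariant under `(R g)ᴴ`, which is the hypothesis at
    -- `g⁻¹`.
    have h := hR g⁻¹
    rw [coe_inv_rep] at h
    rw [Matrix.mem_unitaryGroup_iff, Matrix.star_eq_conjTranspose]
    simp only [Matrix.conjTranspose_mul, Matrix.conjTranspose_conjTranspose]
    calc Aᴴ * ((R g : Matrix n n ℂ) * A) * (Aᴴ * (R g : Matrix n n ℂ)ᴴ * A)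
        = Aᴴ * (R g : Matrix n n ℂ) * (A * (Aᴴ * ((R g : Matrix n n ℂ)ᴴ * A))) := by
          simp only [Matrix.mul_assoc]
      _ = Aᴴ * ((R g : Matrix n n ℂ) * (R g : Matrix n n ℂ)ᴴ) * A := by
          rw [h]; simp only [Matrix.mul_assoc]
      _ = 1 := by rw [rep_mul_conjTranspose, Matrix.mul_one, hA]⟩
  map_one' := by
    apply Subtype.ext
    simp [hA]
  map_mul' g h := by
    apply Subtype.ext
    change Aᴴ * ((R (g * h) : Matrix n n ℂ) * A) =
      Aᴴ * ((R g : Matrix n n ℂ) * A) * (Aᴴ * ((R h : Matrix n n ℂ) * A))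
    rw [coe_rep_mul]
    simp only [Matrix.mul_assoc]
    rw [hR h]

lemma intertwines_compress (R : UnitaryRep G n) (A : Matrix n k ℂ) (hA : Aᴴ * A = 1)
    (hR : ∀ g, A * (Aᴴ * ((R g : Matrix n n ℂ) * A)) = (R g : Matrix n n ℂ) * A) :
    Intertwines (compress R A hA hR) R A := fun g => (hR g).symm

omit [DecidableEq n] [Fintype k] in
lemma isometry_mul {A : Matrix n m ℂ} {B : Matrix m k ℂ} (hA : Aᴴ * A = 1) (hB : Bᴴ * B = 1) :
    (A * B)ᴴ * (A * B) = 1 := by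
  rw [Matrix.conjTranspose_mul, Matrix.mul_assoc, ← Matrix.mul_assoc Aᴴ, hA, Matrix.one_mul, hB]

/-- An equivariant orthogonal projection other than zero dominates an irreducible
subrepresentation. -/
lemma exists_irred_le {R : UnitaryRep G n} {Q : Matrix n n ℂ} (hQ : Intertwines R R Q)
    (hQQ : Q * Q = Q) (h0 : Q ≠ 0) :
    ∃ (l : IrredClass G) (A : Matrix n (Fin l.dim) ℂ),
      Aᴴ * A = 1 ∧ Intertwines l.rep R A ∧ Q * A = A := by
  classical
  -- A subrepresentation of least positive dimension inside the range of `Q` is irreducible. `good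
  -- d` says that such a subrepresentation of dimension `d` exists; `key` supplies one for each
  -- nonzero invariant subspace fixed by `Q`.
  let good : ℕ → Prop := fun d => 0 < d ∧ ∃ (W : UnitaryRep G (Fin d)) (A : Matrix n (Fin d) ℂ),
    Aᴴ * A = 1 ∧ Intertwines W R A ∧ Q * A = A
  have key : ∀ p : Subrepresentation (linearRep R), (∀ v ∈ p, Q *ᵥ v = v) →
      p ≠ ⊥ → good (Module.finrank ℂ p.toSubmodule) := by
    intro p hp hbot
    obtain ⟨A, hA1, hA2, hA3⟩ := exists_isometry_onto p.toSubmodule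
    have hpos : p.toSubmodule ≠ ⊥ := fun h => hbot (Subrepresentation.toSubmodule_injective h)
    refine ⟨Nat.pos_of_ne_zero fun h => hpos (Submodule.finrank_eq_zero.mp h),
      compress R A hA1 fun g => ?_, A, hA1, intertwines_compress _ _ _ _, ?_⟩
    · apply Matrix.toLin'.injective
      refine LinearMap.ext fun w => ?_
      have h := hA3 _ (p.apply_mem_toSubmodule g (hA2 w))
      rw [linearRep_apply] at h
      simpa only [Matrix.toLin'_apply, ← Matrix.mulVec_mulVec] using h
    · apply Matrix.toLin'.injective
      refine LinearMap.ext fun w => ?_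
      have h := hp _ (hA2 w)
      simpa only [Matrix.toLin'_apply, ← Matrix.mulVec_mulVec] using h
  have hex : ∃ d, good d := by
    let p : Subrepresentation (linearRep R) :=
      { toSubmodule := LinearMap.range (Matrix.toLin' Q)
        apply_mem_toSubmodule := by
          rintro g _ ⟨v, rfl⟩
          refine ⟨(R g : Matrix n n ℂ) *ᵥ v, ?_⟩
          rw [linearRep_apply, Matrix.toLin'_apply, Matrix.toLin'_apply, Matrix.mulVec_mulVec,
            Matrix.mulVec_mulVec, hQ g] }
    refine ⟨_, key p ?_ fun h => h0 ?_⟩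
    · rintro _ ⟨v, rfl⟩
      rw [Matrix.toLin'_apply, Matrix.mulVec_mulVec, hQQ]
    · have h2 : LinearMap.range (Matrix.toLin' Q) = ⊥ :=
        congrArg Subrepresentation.toSubmodule h
      rw [LinearMap.range_eq_bot] at h2
      exact Matrix.toLin'.injective (by rw [h2, map_zero])
  obtain ⟨hd, W, A, hA1, hA2, hA3⟩ := Nat.find_spec hex
  have hmin : ∀ {e}, good e → Nat.find hex ≤ e := fun he => Nat.find_min' hex he
  generalize Nat.find hex = d at hd W A hA1 hA2 hA3 hmin
  have hirr : IsIrred W := by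
    have hnt : Nontrivial (Subrepresentation (linearRep W)) := by
      refine ⟨⊥, ⊤, fun h => ?_⟩
      have h1 : (⊥ : Submodule ℂ (Fin d → ℂ)) = ⊤ := congrArg Subrepresentation.toSubmodule h
      have h2 := congrArg (fun p : Submodule ℂ (Fin d → ℂ) => Module.finrank ℂ p) h1
      simp at h2
      omega
    refine { toNontrivial := hnt, eq_bot_or_eq_top := fun q => ?_ }
    by_contra! hq
    -- A proper nonzero invariant subspace of `W` is pushed forward along the injective `A`,
    -- contradicting minimality of `d`.
    let p : Subrepresentation (linearRep R) :=
      { toSubmodule := q.toSubmodule.map (Matrix.toLin' A)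
        apply_mem_toSubmodule := by
          rintro g _ ⟨v, hv, rfl⟩
          refine ⟨(W g : Matrix (Fin d) (Fin d) ℂ) *ᵥ v, ?_, ?_⟩
          · have := q.apply_mem_toSubmodule g hv
            rwa [linearRep_apply] at this
          · rw [linearRep_apply, Matrix.toLin'_apply, Matrix.toLin'_apply, Matrix.mulVec_mulVec,
              Matrix.mulVec_mulVec, hA2 g] }
    have hinj : Function.Injective (Matrix.toLin' A) := by
      apply Function.LeftInverse.injective (g := Matrix.toLin' Aᴴ)
      intro v
      rw [Matrix.toLin'_apply, Matrix.toLin'_apply, Matrix.mulVec_mulVec, hA1, Matrix.one_mulVec]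
    have hfr : Module.finrank ℂ p.toSubmodule = Module.finrank ℂ q.toSubmodule :=
      (Submodule.equivMapOfInjective _ hinj _).finrank_eq.symm
    have hlt : Module.finrank ℂ q.toSubmodule < d := by
      have h1 : q.toSubmodule ≠ ⊤ := fun h => hq.2 (Subrepresentation.toSubmodule_injective h)
      simpa using Submodule.finrank_lt h1
    have hgood := key p ?_ ?_
    · have := hmin hgood
      omega
    · rintro _ ⟨v, _, rfl⟩
      rw [Matrix.toLin'_apply, Matrix.mulVec_mulVec, hA3]
    · intro h
      apply hq.1
      apply Subrepresentation.toSubmodule_injective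
      have h2 : q.toSubmodule.map (Matrix.toLin' A) = ⊥ :=
        congrArg Subrepresentation.toSubmodule h
      exact Submodule.map_injective_of_injective hinj (by rw [h2]; exact (Submodule.map_bot _).symm)
  let w : IrredRep G := ⟨d, W, hirr⟩
  -- `W` need not be the chosen representative of its class; `T` corrects for this.
  obtain ⟨T, h1, h3⟩ : ∃ T : Matrix (Fin d) (Fin (IrredClass.dim ⟦w⟧)) ℂ,
      Tᴴ * T = 1 ∧ Intertwines (IrredClass.rep ⟦w⟧) W T := by
    obtain ⟨T, h1, -, h3⟩ : (Quotient.out (⟦w⟧ : IrredClass G)) ≈ w := Quotient.mk_out w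
    exact ⟨T, h1, h3⟩
  exact ⟨⟦w⟧, A * T, isometry_mul hA1 h1, hA2.mul h3, by rw [← Matrix.mul_assoc, hA3]⟩

omit [DecidableEq n] in
lemma ne_zero_of_isometry [Nonempty m] {A : Matrix n m ℂ} (hA : Aᴴ * A = 1) : A ≠ 0 := by
  rintro rfl
  rw [Matrix.mul_zero] at hA
  exact zero_ne_one hA

omit [DecidableEq n] in
lemma IrredClass.ne_zero_of_isometry {l : IrredClass G} {A : Matrix n (Fin l.dim) ℂ}
    (hA : Aᴴ * A = 1) : A ≠ 0 :=
  have := l.irred.nonempty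
  GateSim.ne_zero_of_isometry hA

/-- Every irreducible unitary representation is equivalent to the representative of its class. -/
lemma IsIrred.exists_class {W : UnitaryRep G m} (hW : IsIrred W) :
    ∃ (l : IrredClass G) (T : Matrix m (Fin l.dim) ℂ),
      Tᴴ * T = 1 ∧ T * Tᴴ = 1 ∧ Intertwines l.rep W T := by
  have := hW.nonempty
  obtain ⟨l, A, h1, h2, -⟩ := exists_irred_le (R := W) (Q := 1) (fun g => by simp) (by simp)
    one_ne_zero
  exact ⟨l, l.irred.exists_unitary hW h2 (IrredClass.ne_zero_of_isometry h1)⟩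

end Intertwiners

/-! ### Multiplicities, isotypic projections and complete reducibility. -/

section Decomposition

variable {G : Type*} [Group G]
  {m n k : Type*} [Fintype m] [DecidableEq m] [Fintype n] [DecidableEq n]
  [Fintype k] [DecidableEq k]

/-- `W ⊗ I_k` occurs in `R` precisely when there are `k` equivariant isometries with pairwise
orthogonal ranges. -/
lemma occursTimes_iff {W : UnitaryRep G m} {R : UnitaryRep G n} {k : ℕ} :
    OccursTimes W k R ↔ ∃ A : Fin k → Matrix n m ℂ,
      (∀ α β, (A α)ᴴ * A β = if α = β then 1 else 0) ∧ ∀ α, Intertwines W R (A α) := by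
  constructor
  · rintro ⟨T, h1, h2⟩
    refine ⟨fun α => T.submatrix id fun c => (c, α), fun α β => ?_, fun α g => ?_⟩
    · ext c d
      have := congrFun (congrFun h1 (c, α)) (d, β)
      rw [Matrix.mul_apply] at this ⊢
      refine this.trans ?_
      by_cases h : α = β <;> simp [Matrix.one_apply, Prod.ext_iff, h]
    · ext x c
      have := congrFun (congrFun (h2 g) x) (c, α)
      rw [Matrix.mul_apply] at this ⊢
      refine this.trans ?_
      rw [Matrix.mul_apply, Matrix.mul_apply, Fintype.sum_prod_type]
      refine Finset.sum_congr rfl fun d _ => ?_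
      simp [Matrix.kroneckerMap_apply, Matrix.one_apply]
  · rintro ⟨A, h1, h2⟩
    refine ⟨Matrix.of fun x c => A c.2 x c.1, ?_, fun g => ?_⟩
    · ext c d
      have := congrFun (congrFun (h1 c.2 d.2) c.1) d.1
      rw [Matrix.mul_apply] at this ⊢
      refine this.trans ?_
      by_cases h : c.2 = d.2 <;> simp [Matrix.one_apply, Prod.ext_iff, h]
    · ext x c
      have := congrFun (congrFun (h2 c.2 g) x) c.1
      rw [Matrix.mul_apply] at this ⊢
      refine this.trans ?_
      rw [Matrix.mul_apply, Matrix.mul_apply, Fintype.sum_prod_type]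
      refine Finset.sum_congr rfl fun d _ => ?_
      simp [Matrix.kroneckerMap_apply, Matrix.one_apply]

/-- The complement `1 - P` equals its own `Xᴴ * X`, so its trace is nonnegative. This is the
dimension count that bounds multiplicities and the number of constituents. -/
lemma trace_re_le_card {P : Matrix n n ℂ} (h1 : Pᴴ = P) (h2 : P * P = P) :
    P.trace.re ≤ Fintype.card n := by
  have h : (1 - P) = (1 - P)ᴴ * (1 - P) := by
    rw [Matrix.conjTranspose_sub, h1, Matrix.conjTranspose_one, Matrix.sub_mul, Matrix.mul_sub,
      Matrix.mul_sub, h2]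
    simp
  have h3 : 0 ≤ (1 - P).trace := by
    rw [h]; exact (Matrix.posSemidef_conjTranspose_mul_self _).trace_nonneg
  have h4 := (Complex.nonneg_iff.mp h3).1
  rw [Matrix.trace_sub, Matrix.trace_one, Complex.sub_re, Complex.natCast_re] at h4
  linarith

/-- The projection onto the joint range of isometries with orthogonal ranges. -/
def rangeProj {ι : Type*} [Fintype ι] (A : ι → Matrix n m ℂ) : Matrix n n ℂ :=
  ∑ α, A α * (A α)ᴴ

section

variable {ι : Type*} [Fintype ι] [DecidableEq ι] {A : ι → Matrix n m ℂ}

omit [DecidableEq m] [Fintype n] [DecidableEq n] [DecidableEq ι] in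
lemma conjTranspose_rangeProj (A : ι → Matrix n m ℂ) : (rangeProj A)ᴴ = rangeProj A := by
  simp [rangeProj, Matrix.conjTranspose_sum]

omit [DecidableEq n] in
lemma rangeProj_mul (hA : ∀ α β, (A α)ᴴ * A β = if α = β then 1 else 0) (β : ι) :
    rangeProj A * A β = A β := by
  rw [rangeProj, Matrix.sum_mul, Finset.sum_eq_single β]
  · rw [Matrix.mul_assoc, hA, if_pos rfl, Matrix.mul_one]
  · intro α _ h
    rw [Matrix.mul_assoc, hA, if_neg h, Matrix.mul_zero]
  · simp

omit [DecidableEq n] in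
lemma rangeProj_mul_self (hA : ∀ α β, (A α)ᴴ * A β = if α = β then 1 else 0) :
    rangeProj A * rangeProj A = rangeProj A := by
  conv_lhs => rw [show rangeProj A * rangeProj A = rangeProj A * ∑ β, A β * (A β)ᴴ from rfl]
  rw [Matrix.mul_sum]
  simp_rw [← Matrix.mul_assoc, rangeProj_mul hA]
  rfl

omit [DecidableEq n] in
lemma trace_rangeProj (hA : ∀ α β, (A α)ᴴ * A β = if α = β then 1 else 0) :
    (rangeProj A).trace = Fintype.card ι * Fintype.card m := by
  simp [rangeProj, Matrix.trace_sum, Matrix.trace_mul_comm (A _), hA]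

end

/-- The projection onto the joint range of `k` copies has trace `k` times the dimension of `W`. The
bound makes the `sSup` defining `multiplicity` a true maximum rather than a default value. -/
lemma OccursTimes.le_card [Nonempty m] {W : UnitaryRep G m} {R : UnitaryRep G n} {k : ℕ}
    (h : OccursTimes W k R) : k ≤ Fintype.card n := by
  obtain ⟨A, h1, -⟩ := occursTimes_iff.mp h
  have h2 := trace_re_le_card (conjTranspose_rangeProj A) (rangeProj_mul_self h1)
  rw [trace_rangeProj h1, Fintype.card_fin] at h2
  have h3 : k * Fintype.card m ≤ Fintype.card n := by
    rw [← Nat.cast_mul, Complex.natCast_re] at h2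
    exact_mod_cast h2
  exact le_trans (Nat.le_mul_of_pos_right k Fintype.card_pos) h3

lemma bddAbove_occursTimes [Nonempty m] (W : UnitaryRep G m) (R : UnitaryRep G n) :
    BddAbove {k | OccursTimes W k R} := ⟨_, fun _ h => h.le_card⟩

lemma OccursTimes.le_multiplicity [Nonempty m] {W : UnitaryRep G m} {R : UnitaryRep G n} {k : ℕ}
    (h : OccursTimes W k R) : k ≤ multiplicity W R := le_csSup (bddAbove_occursTimes W R) h

lemma occursTimes_zero (W : UnitaryRep G m) (R : UnitaryRep G n) : OccursTimes W 0 R :=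
  occursTimes_iff.mpr ⟨fun α => α.elim0, fun α => α.elim0, fun α => α.elim0⟩

lemma occursTimes_multiplicity [Nonempty m] (W : UnitaryRep G m) (R : UnitaryRep G n) :
    OccursTimes W (multiplicity W R) R :=
  Nat.sSup_mem ⟨0, occursTimes_zero W R⟩ (bddAbove_occursTimes W R)

lemma IrredClass.exists_embed (l : IrredClass G) (R : UnitaryRep G n) :
    ∃ A : Fin (multiplicity l.rep R) → Matrix n (Fin l.dim) ℂ,
      (∀ α β, (A α)ᴴ * A β = if α = β then 1 else 0) ∧ ∀ α, Intertwines l.rep R (A α) :=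
  have := l.irred.nonempty
  occursTimes_iff.mp (occursTimes_multiplicity l.rep R)

/-- A maximal family of equivariant isometries from `l` to `R` with orthogonal ranges. -/
noncomputable def IrredClass.embed (l : IrredClass G) (R : UnitaryRep G n) :
    Fin (multiplicity l.rep R) → Matrix n (Fin l.dim) ℂ := (l.exists_embed R).choose

variable (R : UnitaryRep G n) (l l' : IrredClass G)

lemma embed_orthonormal (α β : Fin (multiplicity l.rep R)) :
    (l.embed R α)ᴴ * l.embed R β = if α = β then 1 else 0 := (l.exists_embed R).choose_spec.1 α β

lemma embed_isometry (α : Fin (multiplicity l.rep R)) :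
    (l.embed R α)ᴴ * l.embed R α = 1 := by rw [embed_orthonormal, if_pos rfl]

lemma embed_intertwines (α : Fin (multiplicity l.rep R)) :
    Intertwines l.rep R (l.embed R α) := (l.exists_embed R).choose_spec.2 α

variable {l l'} in
lemma embed_orthogonal (h : l ≠ l') (α : Fin (multiplicity l.rep R))
    (β : Fin (multiplicity l'.rep R)) : (l.embed R α)ᴴ * l'.embed R β = 0 := by
  by_contra h0
  exact h (IrredClass.eq_of_intertwines
    ((embed_intertwines R l α).conjTranspose.mul (embed_intertwines R l' β)) h0).symm

/-- The projection onto the isotypic component of `R` labelled by `l`. -/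
noncomputable def isoProj : Matrix n n ℂ := rangeProj (l.embed R)

lemma isoProj_intertwines : Intertwines R R (isoProj R l) := fun g => by
  rw [isoProj, rangeProj, Matrix.mul_sum, Matrix.sum_mul]
  exact Finset.sum_congr rfl fun α _ =>
    ((embed_intertwines R l α).mul (embed_intertwines R l α).conjTranspose) g

variable {l l'} in
lemma isoProj_mul_embed_of_ne (h : l ≠ l') (β : Fin (multiplicity l'.rep R)) :
    isoProj R l * l'.embed R β = 0 := by
  simp [isoProj, rangeProj, Matrix.sum_mul, Matrix.mul_assoc, embed_orthogonal R h]

lemma isoProj_mul_embed (β : Fin (multiplicity l.rep R)) :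
    isoProj R l * l.embed R β = l.embed R β := rangeProj_mul (embed_orthonormal R l) β

variable {l l'} in
lemma isoProj_mul_of_ne (h : l ≠ l') : isoProj R l * isoProj R l' = 0 := by
  rw [isoProj, isoProj, rangeProj, rangeProj, Matrix.mul_sum]
  refine Finset.sum_eq_zero fun β _ => ?_
  rw [← Matrix.mul_assoc]
  change isoProj R l * l'.embed R β * _ = 0
  rw [isoProj_mul_embed_of_ne R h, Matrix.zero_mul]

lemma isoProj_mul_self : isoProj R l * isoProj R l = isoProj R l :=
  rangeProj_mul_self (embed_orthonormal R l)

lemma trace_isoProj : (isoProj R l).trace = multiplicity l.rep R * l.dim := by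
  rw [isoProj, trace_rangeProj (embed_orthonormal R l), Fintype.card_fin, Fintype.card_fin]

section

variable (s : Finset (IrredClass G))

lemma conjTranspose_sum_isoProj :
    (∑ l ∈ s, isoProj R l)ᴴ = ∑ l ∈ s, isoProj R l := by
  rw [Matrix.conjTranspose_sum]
  exact Finset.sum_congr rfl fun l _ => conjTranspose_rangeProj _

lemma sum_isoProj_mul_embed {s : Finset (IrredClass G)} {l : IrredClass G} (hl : l ∈ s)
    (β : Fin (multiplicity l.rep R)) : (∑ l' ∈ s, isoProj R l') * l.embed R β = l.embed R β := by
  rw [Matrix.sum_mul, Finset.sum_eq_single_of_mem l hl, isoProj_mul_embed]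
  exact fun l' _ h => isoProj_mul_embed_of_ne R h β

lemma sum_isoProj_mul_self :
    (∑ l ∈ s, isoProj R l) * (∑ l ∈ s, isoProj R l) = ∑ l ∈ s, isoProj R l := by
  conv_lhs => rw [Matrix.mul_sum]
  refine Finset.sum_congr rfl fun l hl => ?_
  rw [Matrix.sum_mul, Finset.sum_eq_single_of_mem l hl, isoProj_mul_self]
  exact fun l' _ h => isoProj_mul_of_ne R h

lemma sum_isoProj_intertwines : Intertwines R R (∑ l ∈ s, isoProj R l) := fun g => by
  rw [Matrix.mul_sum, Matrix.sum_mul]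
  exact Finset.sum_congr rfl fun l _ => isoProj_intertwines R l g

end

-- One nonzero equivariant map suffices, since Schur's lemma rescales it to an isometry; no optimal
-- family has to be exhibited.
variable {l} in
lemma mem_Irr_iff :
    l ∈ Irr R ↔ ∃ A : Matrix n (Fin l.dim) ℂ, A ≠ 0 ∧ Intertwines l.rep R A := by
  have := l.irred.nonempty
  constructor
  · intro h
    exact ⟨l.embed R ⟨0, h⟩, IrredClass.ne_zero_of_isometry (embed_isometry R l _),
      embed_intertwines R l _⟩
  · rintro ⟨A, h0, hA⟩
    obtain ⟨r, -, hr⟩ := l.irred.exists_smul_isometry hA h0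
    have : OccursTimes l.rep 1 R := occursTimes_iff.mpr
      ⟨fun _ => r • A, fun α β => by rw [Subsingleton.elim α β, if_pos rfl, hr],
        fun _ => hA.smul r⟩
    exact this.le_multiplicity

lemma finite_Irr : (Irr R).Finite := by
  by_contra hinf
  -- Each constituent contributes at least `1` to the trace of a projection on `ℂⁿ`, so `card n + 1`
  -- of them are too many.
  obtain ⟨s, hs, hcard⟩ := Set.Infinite.exists_subset_card_eq hinf (Fintype.card n + 1)
  have h1 := trace_re_le_card (conjTranspose_sum_isoProj R s) (sum_isoProj_mul_self R s)
  rw [Matrix.trace_sum, Finset.sum_congr rfl fun l _ => trace_isoProj R l] at h1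
  have h2 : ∑ l ∈ s, multiplicity l.rep R * l.dim ≤ Fintype.card n := by
    have h3 : ((∑ l ∈ s, multiplicity l.rep R * l.dim : ℕ) : ℂ).re ≤ Fintype.card n := by
      push_cast; exact h1
    rw [Complex.natCast_re] at h3
    exact_mod_cast h3
  have h3 : ∑ _l ∈ s, 1 ≤ ∑ l ∈ s, multiplicity l.rep R * l.dim :=
    Finset.sum_le_sum fun l hl => Nat.mul_pos (hs hl) l.dim_pos
  rw [Finset.sum_const, hcard] at h3
  simp at h3
  omega

/-- Complete reducibility. -/
lemma sum_isoProj {s : Finset (IrredClass G)} (hs : Irr R ⊆ s) :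
    ∑ l ∈ s, isoProj R l = 1 := by
  by_contra hne
  set P := ∑ l ∈ s, isoProj R l with hP
  have hPP : P * P = P := sum_isoProj_mul_self R s
  have hPi : Intertwines R R P := sum_isoProj_intertwines R s
  obtain ⟨l, A, h1, h2, h3⟩ := exists_irred_le (R := R) (Q := 1 - P)
    (fun g => by rw [Matrix.mul_sub, Matrix.sub_mul, hPi g, Matrix.mul_one, Matrix.one_mul])
    (by rw [Matrix.sub_mul, Matrix.mul_sub, Matrix.mul_sub, hPP]; simp)
    (fun h => hne (sub_eq_zero.mp h).symm)
  have := l.irred.nonempty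
  have hl : l ∈ s := hs ((mem_Irr_iff R).mpr ⟨A, IrredClass.ne_zero_of_isometry h1, h2⟩)
  have hPA : P * A = 0 := by
    rw [Matrix.sub_mul, Matrix.one_mul, sub_eq_self] at h3
    exact h3
  have horth : ∀ β, (l.embed R β)ᴴ * A = 0 := fun β => by
    rw [← sum_isoProj_mul_embed R hl β, Matrix.conjTranspose_mul, conjTranspose_sum_isoProj,
      Matrix.mul_assoc, ← hP, hPA, Matrix.mul_zero]
  have horth' : ∀ β, Aᴴ * l.embed R β = 0 := fun β => by
    have := congrArg Matrix.conjTranspose (horth β)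
    simpa using this
  -- A copy of `l` inside the range of `1 - P` is orthogonal to all copies already counted, so
  -- adjoining it exceeds the maximum.
  have hocc : OccursTimes l.rep (multiplicity l.rep R + 1) R := by
    refine occursTimes_iff.mpr ⟨Fin.cons A (l.embed R), fun α β => ?_, fun α => ?_⟩
    · refine Fin.cases ?_ (fun α => ?_) α <;> refine Fin.cases ?_ (fun β => ?_) β
      · simpa using h1
      · simpa [(Fin.succ_ne_zero β).symm] using horth' β
      · simpa [Fin.succ_ne_zero] using horth α
      · simpa using embed_orthonormal R l α β
    · refine Fin.cases ?_ (fun α => ?_) α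
      · simpa using h2
      · simpa using embed_intertwines R l α
  have := hocc.le_multiplicity
  omega

lemma Irr_nonempty [Nonempty n] : (Irr R).Nonempty := by
  obtain ⟨l, A, h1, h2, -⟩ := exists_irred_le (R := R) (Q := 1) (fun g => by simp) (by simp)
    one_ne_zero
  exact ⟨l, (mem_Irr_iff R).mpr ⟨A, IrredClass.ne_zero_of_isometry h1, h2⟩⟩

/-- Multiplicities do not decrease along equivariant isometries. -/
lemma multiplicity_le_of_intertwines [Nonempty k] (W : UnitaryRep G k) {R : UnitaryRep G n}
    {S : UnitaryRep G m} {A : Matrix m n ℂ} (hA : Aᴴ * A = 1) (h : Intertwines R S A) :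
    multiplicity W R ≤ multiplicity W S := by
  obtain ⟨B, h1, h2⟩ := occursTimes_iff.mp (occursTimes_multiplicity W R)
  refine (occursTimes_iff.mpr ⟨fun α => A * B α, fun α β => ?_, fun α =>
    h.mul (h2 α)⟩ : OccursTimes W _ S).le_multiplicity
  rw [Matrix.conjTranspose_mul, Matrix.mul_assoc, ← Matrix.mul_assoc Aᴴ, hA, Matrix.one_mul, h1]

lemma Irr_subset_of_intertwines {R : UnitaryRep G n} {S : UnitaryRep G m} {A : Matrix m n ℂ}
    (hA : Aᴴ * A = 1) (h : Intertwines R S A) : Irr R ⊆ Irr S := fun l hl =>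
  have := l.irred.nonempty
  lt_of_lt_of_le (α := ℕ) hl (multiplicity_le_of_intertwines l.rep hA h)

end Decomposition

/-! ### Continuity of matrix coefficients passes to constituents, conjugates and tensor products. -/

section Continuity

variable {G : Type*} [Group G] [TopologicalSpace G]
  {m n : Type*} [Fintype m] [DecidableEq m] [Fintype n] [DecidableEq n]

/-- The matrix coefficients are continuous. -/
def ContinuousEntries (R : UnitaryRep G n) : Prop :=
  ∀ i j, Continuous fun g => (R g : Matrix n n ℂ) i j

lemma continuousEntries_of_continuous {R : UnitaryRep G n} (h : Continuous R) :
    ContinuousEntries R := fun i j =>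
  (continuous_subtype_val.comp h).matrix_elem i j

lemma ContinuousEntries.of_intertwines {W : UnitaryRep G m} {R : UnitaryRep G n}
    (hR : ContinuousEntries R) {A : Matrix n m ℂ} (hA : Aᴴ * A = 1) (h : Intertwines W R A) :
    ContinuousEntries W := fun i j => by
  have h1 : ∀ g, (W g : Matrix m m ℂ) = Aᴴ * ((R g : Matrix n n ℂ) * A) := fun g => by
    rw [h g, ← Matrix.mul_assoc, hA, Matrix.one_mul]
  simp_rw [h1, Matrix.mul_apply]
  exact continuous_finsetSum _ fun x _ => continuous_const.mul
    (continuous_finsetSum _ fun y _ => (hR x y).mul continuous_const)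

lemma ContinuousEntries.of_mem_Irr {R : UnitaryRep G n} (hR : ContinuousEntries R)
    {l : IrredClass G} (hl : l ∈ Irr R) : ContinuousEntries l.rep :=
  hR.of_intertwines (embed_isometry R l ⟨0, hl⟩) (embed_intertwines R l ⟨0, hl⟩)

omit [TopologicalSpace G] in
lemma conjRep_apply (U : UnitaryRep G m) (g : G) (i j : m) :
    (conjRep U g : Matrix m m ℂ) i j = star ((U g : Matrix m m ℂ) i j) := rfl

omit [TopologicalSpace G] in
lemma tensorRep_apply (U : UnitaryRep G m) (V : UnitaryRep G n) (g : G) (x y : m × n) :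
    (tensorRep U V g : Matrix (m × n) (m × n) ℂ) x y =
      (U g : Matrix m m ℂ) x.1 y.1 * (V g : Matrix n n ℂ) x.2 y.2 := rfl

lemma ContinuousEntries.conjRep {U : UnitaryRep G m} (hU : ContinuousEntries U) :
    ContinuousEntries (conjRep U) := fun i j => (hU i j).star

lemma ContinuousEntries.tensorRep {U : UnitaryRep G m} {V : UnitaryRep G n}
    (hU : ContinuousEntries U) (hV : ContinuousEntries V) :
    ContinuousEntries (tensorRep U V) := fun _ _ => (hU _ _).mul (hV _ _)

end Continuity

/-! ### Haar averaging, Schur orthogonality and Parseval. -/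

section Orthogonality

variable {G : Type*} [Group G] [TopologicalSpace G] [IsTopologicalGroup G] [CompactSpace G]
  [MeasurableSpace G] [BorelSpace G] (μ : Measure G) [μ.IsHaarMeasure] [IsProbabilityMeasure μ]
  {m n : Type*} [Fintype m] [DecidableEq m] [Fintype n] [DecidableEq n]

omit [Group G] [IsTopologicalGroup G] [μ.IsHaarMeasure] in
lemma integrable_of_continuous {E : Type*} [NormedAddCommGroup E] [SecondCountableTopology E]
    {f : G → E} (hf : Continuous f) : Integrable f μ := by
  refine ⟨hf.aestronglyMeasurable, ?_⟩
  obtain ⟨C, hC⟩ := isCompact_univ.exists_bound_of_continuousOn hf.continuousOn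
  exact HasFiniteIntegral.of_bounded (C := C) (Filter.Eventually.of_forall fun g => hC g trivial)

/-- The average of `R g X (W g)†`. -/
noncomputable def avg (W : UnitaryRep G m) (R : UnitaryRep G n) (X : Matrix n m ℂ) :
    Matrix n m ℂ :=
  Matrix.of fun i j => ∫ g, ((R g : Matrix n n ℂ) * X * (W g : Matrix m m ℂ)ᴴ) i j ∂μ

omit [IsTopologicalGroup G] [CompactSpace G] [MeasurableSpace G] [BorelSpace G] in
lemma continuous_mul_mul {W : UnitaryRep G m} {R : UnitaryRep G n} (hW : ContinuousEntries W)
    (hR : ContinuousEntries R) (X : Matrix n m ℂ) (i : n) (j : m) :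
    Continuous fun g => ((R g : Matrix n n ℂ) * X * (W g : Matrix m m ℂ)ᴴ) i j := by
  simp_rw [Matrix.mul_apply, Matrix.conjTranspose_apply]
  exact continuous_finsetSum _ fun x _ =>
    (continuous_finsetSum _ fun y _ => (hR i y).mul continuous_const).mul (hW j x).star

/-- Left invariance of `μ`: substituting `h * g` for `g` pulls `R h` out on the left and `(W h)ᴴ` on
the right. -/
lemma avg_intertwines {W : UnitaryRep G m} {R : UnitaryRep G n} (hW : ContinuousEntries W)
    (hR : ContinuousEntries R) (X : Matrix n m ℂ) : Intertwines W R (avg μ W R X) := fun h => by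
  ext i j
  have hint : ∀ x y, Integrable
      (fun g => ((R g : Matrix n n ℂ) * X * (W g : Matrix m m ℂ)ᴴ) x y) μ := fun x y =>
    integrable_of_continuous μ (continuous_mul_mul hW hR X x y)
  have h1 : ((R h : Matrix n n ℂ) * avg μ W R X) i j =
      ∫ g, ((R h : Matrix n n ℂ) * ((R g : Matrix n n ℂ) * X * (W g : Matrix m m ℂ)ᴴ)) i j ∂μ := by
    simp only [Matrix.mul_apply (M := (R h : Matrix n n ℂ)), avg, Matrix.of_apply]
    rw [integral_finsetSum _ fun x _ => (hint x j).const_mul _]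
    simp_rw [integral_const_mul]
  have h2 : (avg μ W R X * (W h : Matrix m m ℂ)) i j =
      ∫ g, (((R g : Matrix n n ℂ) * X * (W g : Matrix m m ℂ)ᴴ) * (W h : Matrix m m ℂ)) i j ∂μ := by
    simp only [Matrix.mul_apply (N := (W h : Matrix m m ℂ)), avg, Matrix.of_apply]
    rw [integral_finsetSum _ fun x _ => (hint i x).mul_const _]
    simp_rw [integral_mul_const]
  rw [h1, h2]
  refine Eq.trans ?_ (integral_mul_left_eq_self _ h)
  congr 1
  ext g
  refine congrFun (congrFun ?_ i) j
  rw [coe_rep_mul, coe_rep_mul, Matrix.conjTranspose_mul]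
  simp only [Matrix.mul_assoc]
  rw [conjTranspose_mul_rep, Matrix.mul_one]

-- Averaging a matrix unit isolates a single product of coefficients, so Schur's lemma for `avg`
-- becomes the orthogonality relations.
omit [TopologicalSpace G] [IsTopologicalGroup G] [CompactSpace G] [BorelSpace G]
  [μ.IsHaarMeasure] [IsProbabilityMeasure μ] in
lemma avg_single_apply (W : UnitaryRep G m) (R : UnitaryRep G n) (b a : n) (d c : m) :
    avg μ W R (Matrix.single b d 1) a c =
      ∫ g, (R g : Matrix n n ℂ) a b * star ((W g : Matrix m m ℂ) c d) ∂μ := by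
  simp only [avg, Matrix.of_apply]
  congr 1
  ext g
  rw [Matrix.mul_apply, Finset.sum_eq_single d]
  · simp
  · intro x _ hx
    rw [Matrix.mul_single_apply_of_ne _ _ _ _ _ hx, zero_mul]
  · simp

/-- Schur orthogonality for inequivalent representations. -/
lemma integral_coeff_mul_star_of_ne {l l' : IrredClass G} (h : l ≠ l')
    (hl : ContinuousEntries l.rep) (hl' : ContinuousEntries l'.rep)
    (a b : Fin l.dim) (c d : Fin l'.dim) :
    ∫ g, (l.rep g : Matrix _ _ ℂ) a b * star ((l'.rep g : Matrix _ _ ℂ) c d) ∂μ = 0 := by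
  rw [← avg_single_apply]
  have h0 : avg μ l'.rep l.rep (Matrix.single b d 1) = 0 := by
    by_contra h0
    exact h (IrredClass.eq_of_intertwines (avg_intertwines μ hl' hl _) h0).symm
  rw [h0]
  rfl

/-- Schur orthogonality for the coefficients of one representation. -/
lemma integral_coeff_mul_star_self {l : IrredClass G} (hl : ContinuousEntries l.rep)
    (a b c d : Fin l.dim) :
    ∫ g, (l.rep g : Matrix _ _ ℂ) a b * star ((l.rep g : Matrix _ _ ℂ) c d) ∂μ =
      if a = c ∧ b = d then (l.dim : ℂ)⁻¹ else 0 := by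
  rw [← avg_single_apply]
  obtain ⟨z, hz⟩ := l.irred.exists_eq_smul_one
    (avg_intertwines μ hl hl (Matrix.single b d 1))
  -- Conjugation by a unitary preserves the trace, so the average has the trace of the matrix unit;
  -- dividing by `l.dim` determines the scalar `z`.
  have htr : (avg μ l.rep l.rep (Matrix.single b d 1)).trace = if b = d then 1 else 0 := by
    have h1 : (avg μ l.rep l.rep (Matrix.single b d 1)).trace = ∫ g, ((l.rep g : Matrix _ _ ℂ) *
        Matrix.single b d 1 * (l.rep g : Matrix _ _ ℂ)ᴴ).trace ∂μ := by
      simp only [avg, Matrix.trace, Matrix.diag_apply, Matrix.of_apply]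
      rw [integral_finsetSum _ fun x _ =>
        integrable_of_continuous μ (continuous_mul_mul hl hl _ x x)]
    rw [h1]
    have h2 : ∀ g, ((l.rep g : Matrix _ _ ℂ) * Matrix.single b d (1 : ℂ) *
        (l.rep g : Matrix _ _ ℂ)ᴴ).trace = if b = d then 1 else 0 := fun g => by
      rw [Matrix.trace_mul_comm, ← Matrix.mul_assoc, conjTranspose_mul_rep, Matrix.one_mul]
      split_ifs with h
      · subst h; exact Matrix.trace_single_eq_same _ _
      · exact Matrix.trace_single_eq_of_ne _ _ _ h
    simp_rw [h2]
    simp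
  have hd : (l.dim : ℂ) ≠ 0 := by exact_mod_cast l.dim_pos.ne'
  rw [hz, Matrix.trace_smul, Matrix.trace_one, Fintype.card_fin, smul_eq_mul] at htr
  rw [hz, Matrix.smul_apply, Matrix.one_apply, smul_eq_mul, eq_div_of_mul_eq hd htr]
  by_cases h1 : a = c <;> by_cases h2 : b = d <;> simp [h1, h2]

-- Pythagoras in `L²(μ)`: the cross terms of the expanded square integrate to zero.
omit [Group G] [IsTopologicalGroup G] [μ.IsHaarMeasure] in
lemma integral_norm_sq_sum {ι : Type*} [DecidableEq ι] (s : Finset ι) (φ : ι → G → ℂ) (w : ι → ℝ)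
    (hc : ∀ x ∈ s, Continuous (φ x))
    (ho : ∀ x ∈ s, ∀ y ∈ s, ∫ g, φ x g * star (φ y g) ∂μ = if x = y then (w x : ℂ) else 0)
    (c : ι → ℂ) :
    ∫ g, ‖∑ x ∈ s, c x * φ x g‖ ^ 2 ∂μ = ∑ x ∈ s, w x * ‖c x‖ ^ 2 := by
  apply Complex.ofReal_injective
  rw [← integral_complex_ofReal]
  have h1 : ∀ g, ((‖∑ x ∈ s, c x * φ x g‖ ^ 2 : ℝ) : ℂ) =
      ∑ x ∈ s, ∑ y ∈ s, (c x * star (c y)) * (φ x g * star (φ y g)) := fun g => by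
    rw [Complex.ofReal_pow, ← Complex.mul_conj', map_sum, Finset.sum_mul_sum]
    refine Finset.sum_congr rfl fun x _ => Finset.sum_congr rfl fun y _ => ?_
    simp only [map_mul, Complex.star_def]
    ring
  simp_rw [h1]
  have hint : ∀ x ∈ s, ∀ y ∈ s,
      Integrable (fun g => (c x * star (c y)) * (φ x g * star (φ y g))) μ :=
    fun x hx y hy => (integrable_of_continuous μ ((hc x hx).mul (hc y hy).star)).const_mul _
  rw [integral_finsetSum _ fun x hx => integrable_finsetSum _ fun y hy => hint x hx y hy]
  push_cast
  refine Finset.sum_congr rfl fun x hx => ?_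
  rw [integral_finsetSum _ fun y hy => hint x hx y hy, Finset.sum_eq_single_of_mem x hx]
  · rw [integral_const_mul, ho x hx x hx, if_pos rfl, Complex.star_def, Complex.mul_conj']
    ring
  · intro y hy hxy
    rw [integral_const_mul, ho x hx y hy, if_neg hxy.symm, mul_zero]

/-- Parseval's identity for finite combinations of matrix coefficients. -/
lemma integral_norm_sq_coeff (L : Finset (IrredClass G)) (hL : ∀ l ∈ L, ContinuousEntries l.rep)
    (C : ∀ l : IrredClass G, Matrix (Fin l.dim) (Fin l.dim) ℂ) :
    ∫ g, ‖∑ l ∈ L, ∑ a, ∑ b, C l a b * (l.rep g : Matrix _ _ ℂ) a b‖ ^ 2 ∂μ =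
      ∑ l ∈ L, (l.dim : ℝ)⁻¹ * ∑ a, ∑ b, ‖C l a b‖ ^ 2 := by
  classical
  have h := integral_norm_sq_sum μ
    (ι := Σ l : IrredClass G, Fin l.dim × Fin l.dim) (L.sigma fun _ => Finset.univ)
    (fun x g => (x.1.rep g : Matrix _ _ ℂ) x.2.1 x.2.2) (fun x => (x.1.dim : ℝ)⁻¹)
    (fun x hx => hL x.1 (Finset.mem_sigma.mp hx).1 _ _) ?_ (fun x => C x.1 x.2.1 x.2.2)
  · simp_rw [Finset.sum_sigma, Fintype.sum_prod_type] at h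
    rw [h]
    simp_rw [Finset.mul_sum]
  · rintro ⟨l, a, b⟩ hx ⟨l', c, d⟩ hy
    have hl := hL l (Finset.mem_sigma.mp hx).1
    have hl' := hL l' (Finset.mem_sigma.mp hy).1
    by_cases h : l = l'
    · subst h
      rw [integral_coeff_mul_star_self μ hl]
      simp [Prod.ext_iff]
    · rw [integral_coeff_mul_star_of_ne μ h hl hl', if_neg]
      intro h'
      exact h (congrArg Sigma.fst h')

lemma integral_norm_sq_star_coeff (L : Finset (IrredClass G))
    (hL : ∀ l ∈ L, ContinuousEntries l.rep)
    (C : ∀ l : IrredClass G, Matrix (Fin l.dim) (Fin l.dim) ℂ) :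
    ∫ g, ‖∑ l ∈ L, ∑ a, ∑ b, C l a b * star ((l.rep g : Matrix _ _ ℂ) a b)‖ ^ 2 ∂μ =
      ∑ l ∈ L, (l.dim : ℝ)⁻¹ * ∑ a, ∑ b, ‖C l a b‖ ^ 2 := by
  have h := integral_norm_sq_coeff μ L hL fun l => (C l).map star
  simp only [Matrix.map_apply, norm_star] at h
  rw [← h]
  congr 1
  ext g
  rw [← norm_star]
  simp [star_sum]

end Orthogonality

/-! ### Frobenius norm and compression to blocks. -/

section Frobenius

variable {N k : Type*} [Fintype N] [Fintype k]

/-- The squared Frobenius norm. -/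
noncomputable def normSq {N k : Type*} [Fintype N] [Fintype k] (C : Matrix N k ℂ) : ℝ :=
  ∑ x, ∑ y, ‖C x y‖ ^ 2

lemma normSq_nonneg (C : Matrix N k ℂ) : 0 ≤ normSq C :=
  Finset.sum_nonneg fun _ _ => Finset.sum_nonneg fun _ _ => sq_nonneg _

lemma sum_mul_star_eq_trace (C D : Matrix N k ℂ) :
    ∑ x, ∑ y, C x y * star (D x y) = (C * Dᴴ).trace := by
  simp [Matrix.trace, Matrix.mul_apply]

lemma normSq_eq_trace (C : Matrix N k ℂ) : (normSq C : ℂ) = (C * Cᴴ).trace := by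
  rw [← sum_mul_star_eq_trace, normSq]
  push_cast
  exact Finset.sum_congr rfl fun _ _ => Finset.sum_congr rfl fun _ _ => (Complex.mul_conj' _).symm

lemma normSq_conjTranspose (C : Matrix N k ℂ) : normSq Cᴴ = normSq C := by
  rw [normSq, Finset.sum_comm]
  simp [normSq]

variable [DecidableEq N]

-- Insert the resolution of the identity between `C` and `Cᴴ` in `tr (C Cᴴ)`.
omit [DecidableEq N] in
lemma sum_normSq_mul {ι : Type*} (s : Finset ι) {d : ι → Type*} [∀ x, Fintype (d x)]
    (A : ∀ x, Matrix k (d x) ℂ) [DecidableEq k] (hA : ∑ x ∈ s, A x * (A x)ᴴ = 1)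
    (C : Matrix N k ℂ) : ∑ x ∈ s, normSq (C * A x) = normSq C := by
  apply Complex.ofReal_injective
  push_cast
  simp_rw [normSq_eq_trace]
  calc ∑ x ∈ s, (C * A x * (C * A x)ᴴ).trace = (C * (∑ x ∈ s, A x * (A x)ᴴ) * Cᴴ).trace := by
        rw [Matrix.mul_sum, Matrix.sum_mul, Matrix.trace_sum]
        refine Finset.sum_congr rfl fun x _ => ?_
        rw [Matrix.conjTranspose_mul]
        simp only [Matrix.mul_assoc]
    _ = _ := by rw [hA, Matrix.mul_one]

/-- Compression to mutually orthogonal diagonal blocks does not increase the Frobenius norm. -/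
lemma sum_normSq_compress_le {ι : Type*} (s : Finset ι) {d : ι → Type*} [∀ x, Fintype (d x)]
    (A : ∀ x, Matrix N (d x) ℂ) (hA : ∑ x ∈ s, A x * (A x)ᴴ = 1) (C : Matrix N N ℂ) :
    ∑ x ∈ s, normSq ((A x)ᴴ * C * A x) ≤ normSq C := by
  classical
  rw [← sum_normSq_mul s A hA C]
  refine Finset.sum_le_sum fun x hx => ?_
  -- Resolve the other side of `C` as well, giving all blocks `(x, y)`, and keep only the diagonal
  -- one `y = x`.
  rw [← normSq_conjTranspose (C * A x), ← sum_normSq_mul s A hA]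
  refine le_trans (le_of_eq ?_) (Finset.single_le_sum (fun y _ => normSq_nonneg _) hx)
  rw [← normSq_conjTranspose, Matrix.mul_assoc, Matrix.conjTranspose_mul,
    Matrix.conjTranspose_conjTranspose]

end Frobenius

/-! ### Expanding matrix coefficients into irreducible ones; constituents of `V ⊗ Ū`. -/

section Expansion

variable {G : Type*} [Group G]
  {m n : Type*} [Fintype m] [DecidableEq m] [Fintype n] [DecidableEq n]

/-- The component, in the multiplicity-traced block `l` of `R`, of an operator. -/
noncomputable def blockTrace (R : UnitaryRep G n) (l : IrredClass G) (C : Matrix n n ℂ) :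
    Matrix (Fin l.dim) (Fin l.dim) ℂ :=
  ∑ α, (l.embed R α)ᴴ * C * l.embed R α

/-- A linear combination of conjugate matrix coefficients of `R`, expanded in irreducible ones. -/
lemma sum_mul_star_coeff (R : UnitaryRep G n) {L : Finset (IrredClass G)} (hL : Irr R ⊆ L)
    (C : Matrix n n ℂ) (g : G) :
    ∑ x, ∑ y, C x y * star ((R g : Matrix n n ℂ) x y) =
      ∑ l ∈ L, ∑ a, ∑ b, blockTrace R l C a b * star ((l.rep g : Matrix _ _ ℂ) a b) := by
  simp_rw [sum_mul_star_eq_trace]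
  -- Equivariance at `g⁻¹` moves `(l.rep g)ᴴ` across the embedding, and cyclicity of the trace
  -- collects the embeddings into `isoProj R l`. These projections then sum to `1`.
  have h : ∀ l ∈ L, (blockTrace R l C * (l.rep g : Matrix _ _ ℂ)ᴴ).trace =
      (C * (R g : Matrix n n ℂ)ᴴ * isoProj R l).trace := fun l _ => by
    rw [blockTrace, isoProj, rangeProj, Matrix.sum_mul, Matrix.mul_sum, Matrix.trace_sum,
      Matrix.trace_sum]
    refine Finset.sum_congr rfl fun α _ => ?_
    have h1 := embed_intertwines R l α g⁻¹
    rw [coe_inv_rep, coe_inv_rep] at h1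
    rw [Matrix.mul_assoc, ← h1, ← Matrix.mul_assoc, Matrix.trace_mul_comm, Matrix.trace_mul_comm]
    simp only [Matrix.mul_assoc]
    rw [Matrix.trace_mul_comm]
    simp only [Matrix.mul_assoc]
  rw [Finset.sum_congr rfl h, ← Matrix.trace_sum, ← Matrix.mul_sum, sum_isoProj R hL,
    Matrix.mul_one]

lemma blockTrace_isoProj_self (R : UnitaryRep G n) (l : IrredClass G) :
    blockTrace R l (isoProj R l) = (multiplicity l.rep R : ℂ) • 1 := by
  rw [blockTrace]
  simp_rw [Matrix.mul_assoc, isoProj_mul_embed, embed_isometry]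
  simp [Nat.cast_smul_eq_nsmul]

lemma blockTrace_isoProj_of_ne (R : UnitaryRep G n) {l l' : IrredClass G} (h : l ≠ l') :
    blockTrace R l' (isoProj R l) = 0 := by
  rw [blockTrace]
  simp_rw [Matrix.mul_assoc, isoProj_mul_embed_of_ne R h]
  simp

lemma blockTrace_smul (R : UnitaryRep G n) (l : IrredClass G) (c : ℂ) (C : Matrix n n ℂ) :
    blockTrace R l (c • C) = c • blockTrace R l C := by
  simp [blockTrace, Finset.smul_sum]

/-- The space spanned by the matrix coefficients of a representation. -/
def coeffSpace (U : UnitaryRep G m) : Submodule ℂ (G → ℂ) :=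
  Submodule.span ℂ (Set.range fun p : m × m => fun g => (U g : Matrix m m ℂ) p.1 p.2)

lemma coeff_mem_coeffSpace (U : UnitaryRep G m) (p q : m) :
    (fun g => (U g : Matrix m m ℂ) p q) ∈ coeffSpace U :=
  Submodule.subset_span ⟨(p, q), rfl⟩

lemma mem_coeffSpace_of_sum (U : UnitaryRep G m) (k : m → m → ℂ) :
    (fun g => ∑ p, ∑ q, k p q * (U g : Matrix m m ℂ) p q) ∈ coeffSpace U := by
  have : (fun g => ∑ p, ∑ q, k p q * (U g : Matrix m m ℂ) p q) =
      ∑ p, ∑ q, k p q • fun g => (U g : Matrix m m ℂ) p q := by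
    ext g; simp
  rw [this]
  exact Submodule.sum_mem _ fun p _ => Submodule.sum_mem _ fun q _ =>
    Submodule.smul_mem _ _ (coeff_mem_coeffSpace U p q)

lemma mem_coeffSpace_iff {U : UnitaryRep G m} {φ : G → ℂ} :
    φ ∈ coeffSpace U ↔
      ∃ k : Matrix m m ℂ, ∀ g, φ g = ∑ p, ∑ q, k p q * (U g : Matrix m m ℂ) p q := by
  constructor
  · intro h
    obtain ⟨c, hc⟩ := (Submodule.mem_span_range_iff_exists_fun ℂ).mp h
    refine ⟨Matrix.of fun p q => c (p, q), fun g => ?_⟩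
    rw [← hc]
    simp [Fintype.sum_prod_type]
  · rintro ⟨k, hk⟩
    rw [show φ = _ from funext hk]
    exact mem_coeffSpace_of_sum U k

lemma coeff_mem_coeffSpace_of_mem_Irr (U : UnitaryRep G m) {j : IrredClass G} (hj : j ∈ Irr U)
    (a b : Fin j.dim) : (fun g => (j.rep g : Matrix _ _ ℂ) a b) ∈ coeffSpace U := by
  let A := j.embed U ⟨0, hj⟩
  refine mem_coeffSpace_iff.mpr ⟨Matrix.of fun p q => star (A p a) * A q b, fun g => ?_⟩
  have h : (j.rep g : Matrix _ _ ℂ) = Aᴴ * ((U g : Matrix m m ℂ) * A) := by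
    rw [embed_intertwines U j ⟨0, hj⟩ g, ← Matrix.mul_assoc, embed_isometry, Matrix.one_mul]
  rw [h, Matrix.mul_apply]
  refine Finset.sum_congr rfl fun p _ => ?_
  rw [Matrix.mul_apply, Finset.mul_sum]
  refine Finset.sum_congr rfl fun q _ => ?_
  simp only [Matrix.conjTranspose_apply, Matrix.of_apply]
  ring

lemma exists_expansion {U : UnitaryRep G m} {L : Finset (IrredClass G)} (hL : Irr U ⊆ L)
    {φ : G → ℂ} (hφ : φ ∈ coeffSpace U) :
    ∃ c : ∀ j : IrredClass G, Matrix (Fin j.dim) (Fin j.dim) ℂ,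
      ∀ g, φ g = ∑ j ∈ L, ∑ a, ∑ b, c j a b * (j.rep g : Matrix _ _ ℂ) a b := by
  obtain ⟨k, hk⟩ := mem_coeffSpace_iff.mp hφ
  -- `sum_mul_star_coeff` expands conjugate coefficients, so it is applied to the conjugate of `k`
  -- and the result is conjugated back.
  refine ⟨fun j => (blockTrace U j (k.map star)).map star, fun g => ?_⟩
  have h := congrArg star (sum_mul_star_coeff U hL (k.map star) g)
  simp only [star_sum, star_mul', star_star, Matrix.map_apply] at h
  rw [hk, h]
  rfl

lemma intertwines_one_kronecker_conj {k : Type*} [Fintype k] [DecidableEq k]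
    (V : UnitaryRep G n) {U : UnitaryRep G m} {W : UnitaryRep G k} {S : Matrix m k ℂ}
    (hS : Intertwines W U S) :
    Intertwines (tensorRep V (conjRep W)) (tensorRep V (conjRep U))
      ((1 : Matrix n n ℂ) ⊗ₖ S.map star) := fun g => by
  change ((V g : Matrix n n ℂ) ⊗ₖ (U g : Matrix m m ℂ).map star) * _ =
    _ * ((V g : Matrix n n ℂ) ⊗ₖ (W g : Matrix k k ℂ).map star)
  rw [← Matrix.mul_kronecker_mul, ← Matrix.mul_kronecker_mul, Matrix.one_mul, Matrix.mul_one]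
  congr 1
  have h := congrArg (fun X : Matrix m k ℂ => X.map (starRingEnd ℂ)) (hS g)
  simp only [Matrix.map_mul] at h
  exact h

omit [DecidableEq m] in
lemma conjTranspose_mul_one_kronecker_conj {k : Type*} [Fintype k] [DecidableEq k]
    {S : Matrix m k ℂ} (hS : Sᴴ * S = 1) :
    ((1 : Matrix n n ℂ) ⊗ₖ S.map star)ᴴ * ((1 : Matrix n n ℂ) ⊗ₖ S.map star) = 1 := by
  rw [Matrix.conjTranspose_kronecker, ← Matrix.mul_kronecker_mul, Matrix.conjTranspose_one,
    Matrix.one_mul]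
  have h := congrArg (fun X : Matrix k k ℂ => X.map (starRingEnd ℂ)) hS
  simp only [Matrix.map_mul] at h
  rw [Matrix.map_one _ (map_zero _) (map_one _)] at h
  have h2 : (S.map star)ᴴ = (Sᴴ).map (starRingEnd ℂ) := rfl
  rw [h2]
  exact (congrArg (fun X => (1 : Matrix n n ℂ) ⊗ₖ X) h).trans Matrix.one_kronecker_one

/-- The maps `1 ⊗ S̄`, with `S` running over the embeddings of all `j` into `U`, are equivariant
isometries resolving the identity of `V ⊗ Ū`. An equivariant map killed by all their adjoints is
therefore zero. -/
lemma mem_Irr_tensor_conj_iff (U : UnitaryRep G m) (V : UnitaryRep G n) {l : IrredClass G} :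
    l ∈ Irr (tensorRep V (conjRep U)) ↔
      ∃ j ∈ Irr U, l ∈ Irr (tensorRep V (conjRep j.rep)) := by
  constructor
  · intro hl
    obtain ⟨A, h0, hA⟩ := (mem_Irr_iff _).mp hl
    by_contra! hcon
    apply h0
    have key : ∀ j ∈ Irr U, ∀ α,
        ((1 : Matrix n n ℂ) ⊗ₖ (j.embed U α).map star)ᴴ * A = 0 := fun j hj α => by
      by_contra h
      exact hcon j hj ((mem_Irr_iff _).mpr
        ⟨_, h, (intertwines_one_kronecker_conj V (embed_intertwines U j α)).conjTranspose.mul hA⟩)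
    have h1 : ∑ j ∈ (finite_Irr U).toFinset, ∑ α, ((1 : Matrix n n ℂ) ⊗ₖ (j.embed U α).map star) *
        ((1 : Matrix n n ℂ) ⊗ₖ (j.embed U α).map star)ᴴ = 1 := by
      have h2 := congrArg (fun X : Matrix m m ℂ => (1 : Matrix n n ℂ) ⊗ₖ X.map (starRingEnd ℂ))
        (sum_isoProj U (s := (finite_Irr U).toFinset) (by simp))
      rw [Matrix.map_one _ (map_zero _) (map_one _), Matrix.one_kronecker_one] at h2
      rw [← h2]
      ext x y
      simp only [Matrix.sum_apply, isoProj, rangeProj, Matrix.kroneckerMap_apply, Matrix.map_apply,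
        map_sum, Finset.mul_sum]
      refine Finset.sum_congr rfl fun j _ => Finset.sum_congr rfl fun α _ => ?_
      rw [Matrix.conjTranspose_kronecker, ← Matrix.mul_kronecker_mul, Matrix.conjTranspose_one,
        Matrix.one_mul, Matrix.kroneckerMap_apply]
      congr 1
      simp [Matrix.mul_apply]
    rw [← Matrix.one_mul A, ← h1, Matrix.sum_mul]
    refine Finset.sum_eq_zero fun j hj => ?_
    rw [Matrix.sum_mul]
    refine Finset.sum_eq_zero fun α _ => ?_
    rw [Matrix.mul_assoc, key j (by simpa using hj), Matrix.mul_zero]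
  · rintro ⟨j, hj, hl⟩
    exact Irr_subset_of_intertwines
      (conjTranspose_mul_one_kronecker_conj (embed_isometry U j ⟨0, hj⟩))
      (intertwines_one_kronecker_conj V (embed_intertwines U j ⟨0, hj⟩)) hl

/-- The sum of `d_j m_l^{(j)}` over the irreducible constituents `j` of `U`. -/
noncomputable def weight (U : UnitaryRep G m) (V : UnitaryRep G n) (l : IrredClass G) : ℝ :=
  ∑ j ∈ (finite_Irr U).toFinset,
    (j.dim : ℝ) * multiplicity l.rep (tensorRep V (conjRep j.rep))

lemma weight_nonneg (U : UnitaryRep G m) (V : UnitaryRep G n) (l : IrredClass G) :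
    0 ≤ weight U V l := Finset.sum_nonneg fun _ _ => by positivity

lemma weight_pos (U : UnitaryRep G m) (V : UnitaryRep G n) {l : IrredClass G}
    (hl : l ∈ Irr (tensorRep V (conjRep U))) : 0 < weight U V l := by
  obtain ⟨j, hj, hlj⟩ := (mem_Irr_tensor_conj_iff U V).mp hl
  refine Finset.sum_pos' (fun _ _ => by positivity) ⟨j, by simpa using hj, ?_⟩
  exact mul_pos (by exact_mod_cast j.dim_pos) (by exact_mod_cast hlj)

end Expansion

/-! ### The optimization problem: average overlap of `V` with vectors of coefficients of `U`. -/

section Overlap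

variable {G : Type*} [Group G] [TopologicalSpace G] [IsTopologicalGroup G] [CompactSpace G]
  [MeasurableSpace G] [BorelSpace G] (μ : Measure G) [μ.IsHaarMeasure] [IsProbabilityMeasure μ]
  {m n : Type*} [Fintype m] [DecidableEq m] [Fintype n] [DecidableEq n]

/-- The vector-valued function with coefficient matrices `C j` on `ℂⁿ ⊗ ℂ^{d_j}`. -/
noncomputable def field (L : Finset (IrredClass G))
    (C : ∀ j : IrredClass G, Matrix (n × Fin j.dim) (n × Fin j.dim) ℂ) (x : n × n) (g : G) : ℂ :=
  ∑ j ∈ L, ∑ a, ∑ b, C j (x.1, a) (x.2, b) * (j.rep g : Matrix _ _ ℂ) a b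

omit [DecidableEq n] in
lemma sum_integral_norm_sq_field (L : Finset (IrredClass G))
    (hL : ∀ j ∈ L, ContinuousEntries j.rep)
    (C : ∀ j : IrredClass G, Matrix (n × Fin j.dim) (n × Fin j.dim) ℂ) :
    ∑ x, ∫ g, ‖field L C x g‖ ^ 2 ∂μ = ∑ j ∈ L, (j.dim : ℝ)⁻¹ * normSq (C j) := by
  have h : ∀ x : n × n, ∫ g, ‖field L C x g‖ ^ 2 ∂μ =
      ∑ j ∈ L, (j.dim : ℝ)⁻¹ * ∑ a, ∑ b, ‖C j (x.1, a) (x.2, b)‖ ^ 2 := fun x =>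
    integral_norm_sq_coeff μ L hL fun j => Matrix.of fun a b => C j (x.1, a) (x.2, b)
  simp_rw [h]
  rw [Finset.sum_comm]
  refine Finset.sum_congr rfl fun j _ => ?_
  rw [← Finset.mul_sum]
  congr 1
  simp only [normSq, Fintype.sum_prod_type]
  refine Finset.sum_congr rfl fun i _ => ?_
  rw [Finset.sum_comm]

-- Since `V̄ · j` is the conjugate of `V · j̄`, the overlap is a combination of conjugate
-- coefficients of the representations `V ⊗ j̄`, hence of their constituents. All `j` feeding the
-- same `l` add up before the norm is taken, which is why `l` collects a sum over `j`.
omit [TopologicalSpace G] [IsTopologicalGroup G] [CompactSpace G] [MeasurableSpace G]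
  [BorelSpace G] in
lemma sum_star_mul_field (V : UnitaryRep G n) (L : Finset (IrredClass G))
    {L' : Finset (IrredClass G)} (hL' : ∀ j ∈ L, Irr (tensorRep V (conjRep j.rep)) ⊆ L')
    (C : ∀ j : IrredClass G, Matrix (n × Fin j.dim) (n × Fin j.dim) ℂ) (g : G) :
    ∑ x : n × n, star ((V g : Matrix n n ℂ) x.1 x.2) * field L C x g =
      ∑ l ∈ L', ∑ a, ∑ b,
        (∑ j ∈ L, blockTrace (tensorRep V (conjRep j.rep)) l (C j)) a b *
          star ((l.rep g : Matrix _ _ ℂ) a b) := by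
  have h1 : ∑ x : n × n, star ((V g : Matrix n n ℂ) x.1 x.2) * field L C x g =
      ∑ j ∈ L, ∑ x, ∑ y, C j x y *
        star ((tensorRep V (conjRep j.rep) g : Matrix _ _ ℂ) x y) := by
    simp_rw [field, Finset.mul_sum]
    rw [Finset.sum_comm]
    refine Finset.sum_congr rfl fun j _ => ?_
    simp only [Fintype.sum_prod_type, tensorRep_apply, conjRep_apply, star_mul', star_star]
    refine Finset.sum_congr rfl fun i _ => ?_
    rw [Finset.sum_comm]
    refine Finset.sum_congr rfl fun a _ => Finset.sum_congr rfl fun i' _ =>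
      Finset.sum_congr rfl fun b _ => ?_
    ring
  rw [h1, Finset.sum_congr rfl fun j hj => sum_mul_star_coeff _ (hL' j hj) (C j) g,
    Finset.sum_comm]
  refine Finset.sum_congr rfl fun l _ => ?_
  rw [Finset.sum_comm]
  refine Finset.sum_congr rfl fun a _ => ?_
  rw [Finset.sum_comm]
  refine Finset.sum_congr rfl fun b _ => ?_
  rw [Matrix.sum_apply, Finset.sum_mul]

omit [TopologicalSpace G] [IsTopologicalGroup G] [CompactSpace G] [MeasurableSpace G]
  [BorelSpace G] in
/-- Cauchy–Schwarz for the sum over the copies of `l`. -/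
lemma normSq_sum_blockTrace_le (V : UnitaryRep G n) (L : Finset (IrredClass G))
    (C : ∀ j : IrredClass G, Matrix (n × Fin j.dim) (n × Fin j.dim) ℂ) (l : IrredClass G) :
    normSq (∑ j ∈ L, blockTrace (tensorRep V (conjRep j.rep)) l (C j)) ≤
      (∑ j ∈ L, (j.dim : ℝ) * multiplicity l.rep (tensorRep V (conjRep j.rep))) *
        ∑ j ∈ L, (j.dim : ℝ)⁻¹ * ∑ α,
          normSq ((l.embed (tensorRep V (conjRep j.rep)) α)ᴴ * C j *
            l.embed (tensorRep V (conjRep j.rep)) α) := by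
  let s := L.sigma fun j => (Finset.univ :
    Finset (Fin (multiplicity l.rep (tensorRep V (conjRep j.rep)))))
  let B : (Σ j : IrredClass G, Fin (multiplicity l.rep (tensorRep V (conjRep j.rep)))) →
      Matrix (Fin l.dim) (Fin l.dim) ℂ := fun x =>
    (l.embed (tensorRep V (conjRep x.1.rep)) x.2)ᴴ * C x.1 *
      l.embed (tensorRep V (conjRep x.1.rep)) x.2
  have hd : ∀ j : IrredClass G, (0 : ℝ) < j.dim := fun j => by exact_mod_cast j.dim_pos
  have h1 : ∑ j ∈ L, blockTrace (tensorRep V (conjRep j.rep)) l (C j) = ∑ x ∈ s, B x := by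
    rw [Finset.sum_sigma]
    rfl
  have h2 : ∑ j ∈ L, (j.dim : ℝ) * multiplicity l.rep (tensorRep V (conjRep j.rep)) =
      ∑ x ∈ s, (x.1.dim : ℝ) := by
    rw [Finset.sum_sigma]
    exact Finset.sum_congr rfl fun j _ => by simp [mul_comm]
  have h3 : ∑ j ∈ L, (j.dim : ℝ)⁻¹ * ∑ α, normSq ((l.embed (tensorRep V (conjRep j.rep)) α)ᴴ *
      C j * l.embed (tensorRep V (conjRep j.rep)) α) = ∑ x ∈ s, (x.1.dim : ℝ)⁻¹ * normSq (B x) := by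
    rw [Finset.sum_sigma]
    exact Finset.sum_congr rfl fun j _ => Finset.mul_sum _ _ _
  rw [h1, h2, h3]
  -- Cauchy–Schwarz with the factorization `‖B‖² = d_j · (d_j⁻¹ ‖B‖²)`; the factor `d_j⁻¹` is the
  -- one with which `C j` enters the norm of the field.
  have h4 : ∀ a b, ‖(∑ x ∈ s, B x) a b‖ ^ 2 ≤
      (∑ x ∈ s, (x.1.dim : ℝ)) * ∑ x ∈ s, (x.1.dim : ℝ)⁻¹ * ‖B x a b‖ ^ 2 := fun a b => by
    rw [Matrix.sum_apply]
    refine le_trans (pow_le_pow_left₀ (norm_nonneg _) (norm_sum_le _ _) 2) ?_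
    refine Finset.sum_sq_le_sum_mul_sum_of_sq_le_mul s (fun x _ => (hd x.1).le)
      (fun x _ => mul_nonneg (inv_nonneg.mpr (hd x.1).le) (sq_nonneg _)) fun x _ => ?_
    exact le_of_eq (by rw [← mul_assoc, mul_inv_cancel₀ (hd x.1).ne', one_mul])
  calc normSq (∑ x ∈ s, B x)
      ≤ ∑ a, ∑ b, (∑ x ∈ s, (x.1.dim : ℝ)) * ∑ x ∈ s, (x.1.dim : ℝ)⁻¹ * ‖B x a b‖ ^ 2 :=
        Finset.sum_le_sum fun a _ => Finset.sum_le_sum fun b _ => h4 a b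
    _ = _ := by
        simp only [normSq, ← Finset.mul_sum]
        congr 1
        simp only [Finset.mul_sum]
        rw [Finset.sum_congr rfl fun a _ => Finset.sum_comm, Finset.sum_comm]

/-- Upper bound on the average overlap with `V` of vectors whose entries are matrix coefficients
of `U`. -/
theorem integral_overlap_le {U : UnitaryRep G m} {V : UnitaryRep G n} (hU : ContinuousEntries U)
    (hV : ContinuousEntries V) {f : n × n → G → ℂ} (hf : ∀ x, f x ∈ coeffSpace U) {B : ℝ}
    (hB0 : 0 ≤ B)
    (hB : ∀ l ∈ Irr (tensorRep V (conjRep U)), weight U V l ≤ B * l.dim) :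
    ∫ g, ‖∑ x, star ((V g : Matrix n n ℂ) x.1 x.2) * f x g‖ ^ 2 ∂μ ≤
      B * ∑ x, ∫ g, ‖f x g‖ ^ 2 ∂μ := by
  classical
  set L := (finite_Irr U).toFinset with hLdef
  set L' := (finite_Irr (tensorRep V (conjRep U))).toFinset with hLdef'
  have hLc : ∀ j ∈ L, ContinuousEntries j.rep := fun j hj =>
    hU.of_mem_Irr (by simpa [hLdef] using hj)
  have hLc' : ∀ l ∈ L', ContinuousEntries l.rep := fun l hl =>
    (hV.tensorRep hU.conjRep).of_mem_Irr (by simpa [hLdef'] using hl)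
  have hsub : ∀ j ∈ L, Irr (tensorRep V (conjRep j.rep)) ⊆ L' := fun j hj l hl => by
    simpa [hLdef'] using (mem_Irr_tensor_conj_iff U V).mpr ⟨j, by simpa [hLdef] using hj, hl⟩
  choose c hc using fun x => exists_expansion (L := L) (by simp [hLdef]) (hf x)
  let C : ∀ j : IrredClass G, Matrix (n × Fin j.dim) (n × Fin j.dim) ℂ := fun j =>
    Matrix.of fun x y => c (x.1, y.1) j x.2 y.2
  obtain rfl : f = field L C := by
    ext x g
    exact hc x g
  have hd : ∀ j : IrredClass G, (0 : ℝ) < j.dim := fun j => by exact_mod_cast j.dim_pos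
  rw [sum_integral_norm_sq_field μ L hLc]
  simp_rw [sum_star_mul_field V L hsub]
  rw [integral_norm_sq_star_coeff μ L' hLc'
    fun l => ∑ j ∈ L, blockTrace (tensorRep V (conjRep j.rep)) l (C j)]
  let S : IrredClass G → IrredClass G → ℝ := fun l j => ∑ α,
    normSq ((l.embed (tensorRep V (conjRep j.rep)) α)ᴴ * C j *
      l.embed (tensorRep V (conjRep j.rep)) α)
  have hS : ∀ l j, 0 ≤ S l j := fun l j => Finset.sum_nonneg fun α _ => normSq_nonneg _
  calc ∑ l ∈ L', (l.dim : ℝ)⁻¹ *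
        normSq (∑ j ∈ L, blockTrace (tensorRep V (conjRep j.rep)) l (C j))
      ≤ ∑ l ∈ L', B * ∑ j ∈ L, (j.dim : ℝ)⁻¹ * S l j := by
        refine Finset.sum_le_sum fun l hl => ?_
        have h1 := normSq_sum_blockTrace_le V L C l
        have h2 : (∑ j ∈ L, (j.dim : ℝ) * multiplicity l.rep (tensorRep V (conjRep j.rep))) ≤
          B * l.dim := hB l (by simpa [hLdef'] using hl)
        have h3 : 0 ≤ ∑ j ∈ L, (j.dim : ℝ)⁻¹ * S l j :=
          Finset.sum_nonneg fun j _ => mul_nonneg (inv_nonneg.mpr (hd j).le) (hS l j)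
        rw [inv_mul_le_iff₀ (hd l)]
        refine h1.trans ((mul_le_mul_of_nonneg_right h2 h3).trans (le_of_eq ?_))
        ring
    _ = B * ∑ j ∈ L, (j.dim : ℝ)⁻¹ * ∑ l ∈ L', S l j := by
        rw [← Finset.mul_sum, Finset.sum_comm]
        simp_rw [Finset.mul_sum]
    _ ≤ B * ∑ j ∈ L, (j.dim : ℝ)⁻¹ * normSq (C j) := by
        refine mul_le_mul_of_nonneg_left (Finset.sum_le_sum fun j hj => ?_) hB0
        refine mul_le_mul_of_nonneg_left ?_ (inv_nonneg.mpr (hd j).le)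
        -- For fixed `j`, all copies of all `l ∈ L'` are orthogonal blocks of `V ⊗ j̄` resolving the
        -- identity.
        have h := sum_normSq_compress_le
          (L'.sigma fun l => (Finset.univ :
            Finset (Fin (multiplicity l.rep (tensorRep V (conjRep j.rep))))))
          (fun x => x.1.embed (tensorRep V (conjRep j.rep)) x.2)
          (by rw [Finset.sum_sigma]; exact sum_isoProj _ (hsub j hj)) (C j)
        rwa [Finset.sum_sigma] at h

/-- The bound of `integral_overlap_le` is reached, for every constituent `l` of `V ⊗ Ū`. -/
theorem exists_integral_overlap_eq {U : UnitaryRep G m} {V : UnitaryRep G n}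
    (hU : ContinuousEntries U) (hV : ContinuousEntries V) {l : IrredClass G}
    (hl : l ∈ Irr (tensorRep V (conjRep U))) :
    ∃ f : n × n → G → ℂ, (∀ x, f x ∈ coeffSpace U) ∧ 0 < ∑ x, ∫ g, ‖f x g‖ ^ 2 ∂μ ∧
      (∫ g, ‖∑ x, star ((V g : Matrix n n ℂ) x.1 x.2) * f x g‖ ^ 2 ∂μ) * l.dim =
        weight U V l * ∑ x, ∫ g, ‖f x g‖ ^ 2 ∂μ := by
  classical
  set L := (finite_Irr U).toFinset with hLdef
  set L' := (finite_Irr (tensorRep V (conjRep U))).toFinset with hLdef'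
  have hLc : ∀ j ∈ L, ContinuousEntries j.rep := fun j hj =>
    hU.of_mem_Irr (by simpa [hLdef] using hj)
  have hLc' : ∀ l ∈ L', ContinuousEntries l.rep := fun l hl =>
    (hV.tensorRep hU.conjRep).of_mem_Irr (by simpa [hLdef'] using hl)
  have hsub : ∀ j ∈ L, Irr (tensorRep V (conjRep j.rep)) ⊆ L' := fun j hj l hl => by
    simpa [hLdef'] using (mem_Irr_tensor_conj_iff U V).mpr ⟨j, by simpa [hLdef] using hj, hl⟩
  have hd : ∀ j : IrredClass G, (0 : ℝ) < j.dim := fun j => by exact_mod_cast j.dim_pos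
  -- This makes both inequalities tight: only the blocks of `l` are nonzero, so compression loses
  -- nothing, and each block is `d_j • 1`, proportional to the Cauchy–Schwarz weight `d_j`.
  let C : ∀ j : IrredClass G, Matrix (n × Fin j.dim) (n × Fin j.dim) ℂ := fun j =>
    (j.dim : ℂ) • isoProj (tensorRep V (conjRep j.rep)) l
  have hnorm : ∑ x, ∫ g, ‖field L C x g‖ ^ 2 ∂μ = weight U V l * l.dim := by
    rw [sum_integral_norm_sq_field μ L hLc, weight, Finset.sum_mul]
    refine Finset.sum_congr rfl fun j _ => ?_
    have h1 : normSq (C j) = (j.dim : ℝ) ^ 2 *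
        (multiplicity l.rep (tensorRep V (conjRep j.rep)) * l.dim) := by
      apply Complex.ofReal_injective
      rw [normSq_eq_trace, Matrix.conjTranspose_smul, Matrix.smul_mul, Matrix.mul_smul,
        show (isoProj (tensorRep V (conjRep j.rep)) l)ᴴ = isoProj _ l from
          conjTranspose_rangeProj _, isoProj_mul_self, smul_smul, Matrix.trace_smul, trace_isoProj]
      simp [sq, mul_assoc]
    rw [h1]
    have := (hd j).ne'
    field_simp
  have hover : ∫ g, ‖∑ x : n × n, star ((V g : Matrix n n ℂ) x.1 x.2) * field L C x g‖ ^ 2 ∂μ =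
      weight U V l ^ 2 := by
    simp_rw [sum_star_mul_field V L hsub]
    rw [integral_norm_sq_star_coeff μ L' hLc'
      fun l => ∑ j ∈ L, blockTrace (tensorRep V (conjRep j.rep)) l (C j),
      Finset.sum_eq_single_of_mem l (by simpa [hLdef'] using hl)]
    · have h1 : ∑ j ∈ L, blockTrace (tensorRep V (conjRep j.rep)) l (C j) =
          (weight U V l : ℂ) • 1 := by
        simp_rw [C, blockTrace_smul, blockTrace_isoProj_self, smul_smul]
        rw [← Finset.sum_smul, weight]
        push_cast
        rfl
      rw [h1]
      change (l.dim : ℝ)⁻¹ *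
        normSq ((weight U V l : ℂ) • (1 : Matrix (Fin l.dim) (Fin l.dim) ℂ)) = _
      have h2 : normSq ((weight U V l : ℂ) • (1 : Matrix (Fin l.dim) (Fin l.dim) ℂ)) =
          weight U V l ^ 2 * l.dim := by
        apply Complex.ofReal_injective
        rw [normSq_eq_trace, Matrix.conjTranspose_smul, Matrix.smul_mul, Matrix.mul_smul,
          smul_smul, Matrix.trace_smul, Matrix.conjTranspose_one, Matrix.one_mul, Matrix.trace_one]
        simp [sq, mul_assoc]
      rw [h2]
      have := (hd l).ne'
      field_simp
    · intro l' _ hne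
      have h1 : ∑ j ∈ L, blockTrace (tensorRep V (conjRep j.rep)) l' (C j) = 0 := by
        refine Finset.sum_eq_zero fun j _ => ?_
        rw [blockTrace_smul, blockTrace_isoProj_of_ne _ hne.symm, smul_zero]
      rw [h1]
      simp
  refine ⟨field L C, fun x => ?_, ?_, ?_⟩
  · have : field L C x = ∑ j ∈ L, ∑ a, ∑ b, C j (x.1, a) (x.2, b) •
        fun g => (j.rep g : Matrix _ _ ℂ) a b := by
      ext g; simp [field]
    rw [this]
    exact Submodule.sum_mem _ fun j hj => Submodule.sum_mem _ fun a _ => Submodule.sum_mem _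
      fun b _ => Submodule.smul_mem _ _
        (coeff_mem_coeffSpace_of_mem_Irr U (by simpa [hLdef] using hj) a b)
  · rw [hnorm]
    exact mul_pos (weight_pos U V hl) (hd l)
  · rw [hnorm, hover]
    ring

end Overlap

/-! ### Kraus decompositions and rescaling a single Kraus operator to a quantum operation. -/

section Kraus

variable {a b c : Type*} [Fintype a] [DecidableEq a] [Fintype b] [DecidableEq b] [Fintype c]

lemma exists_eq_conjTranspose_mul_self {M : Matrix a a ℂ} (h : M.PosSemidef) :
    ∃ B : Matrix a a ℂ, M = Bᴴ * B := by
  open scoped MatrixOrder in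
  exact CStarAlgebra.nonneg_iff_eq_star_mul_self.mp h.nonneg

omit [DecidableEq a] [Fintype b] [DecidableEq b] in
lemma mul_mul_conjTranspose_apply (K : Matrix b a ℂ) (X : Matrix a a ℂ) (y y' : b) :
    (K * X * Kᴴ) y y' = ∑ i, ∑ j, K y i * X i j * star (K y' j) := by
  simp_rw [Matrix.mul_apply, Matrix.conjTranspose_apply, Finset.sum_mul]
  exact Finset.sum_comm

omit [DecidableEq b] in
/-- Every completely positive map has a Kraus decomposition. -/
theorem IsCompletelyPositive.exists_kraus {Φ : Matrix a a ℂ →ₗ[ℂ] Matrix b b ℂ}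
    (h : IsCompletelyPositive Φ) :
    ∃ K : b × Fin (Fintype.card a) → Matrix b a ℂ, ∀ X, Φ X = ∑ κ, K κ * X * (K κ)ᴴ := by
  classical
  let e := Fintype.equivFin a
  -- The unnormalized maximally entangled vector. The ancilla is relabelled by `Fin`, as complete
  -- positivity quantifies over `Fin k`; the image of `ω` is the Choi matrix, and its factor `B`
  -- yields the Kraus operators.
  let ω : a × Fin (Fintype.card a) → ℂ := fun x => if e x.1 = x.2 then 1 else 0
  obtain ⟨B, hB⟩ := exists_eq_conjTranspose_mul_self
    (h _ _ (Matrix.posSemidef_vecMulVec_self_star ω))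
  have hchoi : ∀ i j y y', Φ (Matrix.single i j 1) y y' =
      ∑ κ, star (B κ (y, e i)) * B κ (y', e j) := fun i j y y' => by
    have h1 := congrFun (congrFun hB (y, e i)) (y', e j)
    rw [Matrix.mul_apply] at h1
    simp only [Matrix.conjTranspose_apply] at h1
    rw [← h1]
    change _ = Φ (Matrix.of fun p q => Matrix.vecMulVec ω (star ω) (p, e i) (q, e j)) y y'
    refine congrFun (congrFun (congrArg Φ ?_) y) y'
    ext p q
    simp only [Matrix.single_apply, Matrix.of_apply, Matrix.vecMulVec_apply, ω, Pi.star_apply,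
      EmbeddingLike.apply_eq_iff_eq]
    by_cases h1 : p = i <;> by_cases h2 : q = j <;>
      simp [eq_comm (a := i), eq_comm (a := j), h1, h2]
  refine ⟨fun κ => Matrix.of fun y i => star (B κ (y, e i)), fun X => ?_⟩
  ext y y'
  have h2 : Φ X y y' = ∑ i, ∑ j, X i j * Φ (Matrix.single i j 1) y y' := by
    conv_lhs => rw [Matrix.matrix_eq_sum_single X]
    simp only [map_sum, Matrix.sum_apply]
    refine Finset.sum_congr rfl fun i _ => Finset.sum_congr rfl fun j _ => ?_
    rw [show Matrix.single i j (X i j) = X i j • Matrix.single i j (1 : ℂ) by simp, map_smul]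
    rfl
  rw [h2, Matrix.sum_apply]
  simp_rw [mul_mul_conjTranspose_apply, hchoi, Finset.mul_sum]
  rw [Finset.sum_congr rfl fun i _ => Finset.sum_comm, Finset.sum_comm]
  refine Finset.sum_congr rfl fun κ _ => Finset.sum_congr rfl fun i _ =>
    Finset.sum_congr rfl fun j _ => ?_
  simp only [Matrix.of_apply, star_star]
  ring

omit [DecidableEq a] [Fintype b] [DecidableEq b] in
lemma ampliate_eq_sum {ι : Type*} [Fintype ι] {Φ : Matrix a a ℂ →ₗ[ℂ] Matrix b b ℂ}
    {K : ι → Matrix b a ℂ} (hK : ∀ X, Φ X = ∑ κ, K κ * X * (K κ)ᴴ)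
    (r : Type*) [Fintype r] [DecidableEq r] (X : Matrix (a × r) (a × r) ℂ) :
    ampliate Φ r X =
      ∑ κ, (K κ ⊗ₖ (1 : Matrix r r ℂ)) * X * (K κ ⊗ₖ (1 : Matrix r r ℂ))ᴴ := by
  ext ⟨y, s⟩ ⟨y', s'⟩
  change Φ (Matrix.of fun i j => X (i, s) (j, s')) y y' = _
  rw [hK, Matrix.sum_apply, Matrix.sum_apply]
  refine Finset.sum_congr rfl fun κ _ => ?_
  rw [mul_mul_conjTranspose_apply, mul_mul_conjTranspose_apply]
  simp only [Fintype.sum_prod_type, Matrix.kroneckerMap_apply, Matrix.one_apply, Matrix.of_apply]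
  refine Finset.sum_congr rfl fun i _ => ?_
  rw [Finset.sum_eq_single s (by intro t _ ht; simp [ht.symm]) (by simp)]
  refine Finset.sum_congr rfl fun j _ => ?_
  rw [Finset.sum_eq_single s' (by intro t _ ht; simp [ht.symm]) (by simp)]
  simp

lemma ampliate_comp {a b c : Type*} (Ψ : Matrix b b ℂ →ₗ[ℂ] Matrix c c ℂ)
    (Φ : Matrix a a ℂ →ₗ[ℂ] Matrix b b ℂ) (r : Type*) (X : Matrix (a × r) (a × r) ℂ) :
    ampliate (Ψ ∘ₗ Φ) r X = ampliate Ψ r (ampliate Φ r X) := rfl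

omit [DecidableEq a] [Fintype b] [DecidableEq b] in
lemma mul_ketbra_mul (K : Matrix b a ℂ) (ψ : a → ℂ) :
    K * ketbra ψ * Kᴴ = ketbra (K *ᵥ ψ) := by
  rw [ketbra, ketbra, Matrix.mul_vecMulVec, Matrix.vecMulVec_mul, Matrix.star_mulVec]

/-- The map `X ↦ L X L†`. -/
def krausMap (L : Matrix b a ℂ) : Matrix a a ℂ →ₗ[ℂ] Matrix b b ℂ where
  toFun X := L * X * Lᴴ
  map_add' X Y := by rw [Matrix.mul_add, Matrix.add_mul]
  map_smul' c X := by simp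

omit [DecidableEq a] [Fintype b] [DecidableEq b] in
lemma krausMap_apply (L : Matrix b a ℂ) (X : Matrix a a ℂ) : krausMap L X = L * X * Lᴴ := rfl

omit [DecidableEq a] [Fintype b] [DecidableEq b] in
lemma ampliate_krausMap (L : Matrix b a ℂ) (r : Type*) [Fintype r] [DecidableEq r]
    (X : Matrix (a × r) (a × r) ℂ) :
    ampliate (krausMap L) r X =
      (L ⊗ₖ (1 : Matrix r r ℂ)) * X * (L ⊗ₖ (1 : Matrix r r ℂ))ᴴ := by
  rw [ampliate_eq_sum (ι := Unit) (K := fun _ => L) (fun X => by simp [krausMap])]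
  simp

omit [DecidableEq a] [DecidableEq b] in
lemma isCompletelyPositive_krausMap (L : Matrix b a ℂ) :
    IsCompletelyPositive (krausMap L) := fun k X hX => by
  rw [ampliate_krausMap]
  exact hX.mul_mul_conjTranspose_same _

-- Entrywise Cauchy–Schwarz. It gives a crude bound on the trace gain of `X ↦ L X L†`, sufficient
-- because only some positive rescaling is needed.
omit [DecidableEq a] [DecidableEq b] in
lemma normSq_mul_le (A : Matrix b a ℂ) (B : Matrix a c ℂ) :
    normSq (A * B) ≤ normSq A * normSq B := by
  have h1 : ∀ x y, ‖(A * B) x y‖ ^ 2 ≤ (∑ z, ‖A x z‖ ^ 2) * ∑ z, ‖B z y‖ ^ 2 := fun x y => by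
    rw [Matrix.mul_apply]
    refine le_trans (pow_le_pow_left₀ (norm_nonneg _) (norm_sum_le _ _) 2) ?_
    simp_rw [norm_mul]
    exact Finset.sum_mul_sq_le_sq_mul_sq _ _ _
  calc normSq (A * B) ≤ ∑ x, ∑ y, (∑ z, ‖A x z‖ ^ 2) * ∑ z, ‖B z y‖ ^ 2 :=
        Finset.sum_le_sum fun x _ => Finset.sum_le_sum fun y _ => h1 x y
    _ = normSq A * normSq B := by
        simp_rw [← Finset.mul_sum, ← Finset.sum_mul]
        rw [Finset.sum_comm (f := fun y z => ‖B z y‖ ^ 2)]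
        rfl

omit [DecidableEq b] in
/-- Every `X ↦ L X L†` becomes a quantum operation after rescaling. -/
lemma exists_isQuantumOperation_krausMap_smul (L : Matrix b a ℂ) :
    ∃ s : ℝ, 0 < s ∧ IsQuantumOperation (krausMap ((s : ℂ) • L)) := by
  have h0 := normSq_nonneg L
  -- The scale satisfies `s² ‖L‖² ≤ 1`; the added `1` keeps it positive even when `L = 0`.
  refine ⟨(Real.sqrt (1 + normSq L))⁻¹, by positivity, isCompletelyPositive_krausMap _,
    fun X hX => ?_⟩
  obtain ⟨B, rfl⟩ := exists_eq_conjTranspose_mul_self hX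
  set s := (Real.sqrt (1 + normSq L))⁻¹ with hs
  have h2 : (krausMap ((s : ℂ) • L) (Bᴴ * B)).trace.re = s ^ 2 * normSq (L * Bᴴ) := by
    have h3 : krausMap ((s : ℂ) • L) (Bᴴ * B) =
        ((s ^ 2 : ℝ) : ℂ) • ((L * Bᴴ) * (L * Bᴴ)ᴴ) := by
      simp only [krausMap, LinearMap.coe_mk, AddHom.coe_mk, Matrix.conjTranspose_smul,
        Matrix.smul_mul, Matrix.mul_smul, smul_smul, Matrix.conjTranspose_mul,
        Matrix.conjTranspose_conjTranspose, Matrix.mul_assoc]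
      congr 1
      simp [sq]
    rw [h3, Matrix.trace_smul, ← normSq_eq_trace, smul_eq_mul, ← Complex.ofReal_mul,
      Complex.ofReal_re]
  have h4 : (Bᴴ * B).trace.re = normSq Bᴴ := by
    rw [← Complex.ofReal_re (normSq Bᴴ), normSq_eq_trace, Matrix.conjTranspose_conjTranspose]
  have h5 : s ^ 2 * normSq L ≤ 1 := by
    rw [hs, inv_pow, Real.sq_sqrt (by positivity), inv_mul_le_iff₀ (by positivity)]
    linarith
  rw [h2, h4]
  calc s ^ 2 * normSq (L * Bᴴ) ≤ s ^ 2 * (normSq L * normSq Bᴴ) :=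
        mul_le_mul_of_nonneg_left (normSq_mul_le _ _) (sq_nonneg _)
    _ = (s ^ 2 * normSq L) * normSq Bᴴ := by ring
    _ ≤ 1 * normSq Bᴴ := mul_le_mul_of_nonneg_right h5 (normSq_nonneg _)
    _ = normSq Bᴴ := one_mul _

end Kraus

/-! ### Fidelity and trace of rank-one operators; entries of Bell states. -/

section Fidelity

variable {a : Type*} [Fintype a]

lemma fidelity_ketbra (ψ v : a → ℂ) : fidelity ψ (ketbra v) = ‖∑ x, star (ψ x) * v x‖ ^ 2 := by
  rw [fidelity, ketbra, Matrix.vecMulVec_mulVec]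
  have h : star ψ ⬝ᵥ (MulOpposite.op (star v ⬝ᵥ ψ) • v) =
      (∑ x, star (ψ x) * v x) * star (∑ x, star (ψ x) * v x) := by
    simp only [dotProduct, Pi.star_apply, Pi.smul_apply, op_smul_eq_mul, star_sum,
      star_mul', star_star]
    rw [Finset.sum_mul]
    refine Finset.sum_congr rfl fun x _ => ?_
    rw [← mul_assoc]
    congr 1
    exact Finset.sum_congr rfl fun y _ => mul_comm _ _
  rw [h, Complex.star_def, Complex.mul_conj', ← Complex.ofReal_pow, Complex.ofReal_re]

lemma trace_ketbra (v : a → ℂ) : (ketbra v).trace.re = ∑ x, ‖v x‖ ^ 2 := by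
  rw [ketbra, Matrix.trace_vecMulVec, dotProduct, Complex.re_sum]
  refine Finset.sum_congr rfl fun x _ => ?_
  rw [Pi.star_apply, Complex.star_def, Complex.mul_conj', ← Complex.ofReal_pow, Complex.ofReal_re]

lemma fidelity_sum {ι : Type*} (s : Finset ι) (ψ : a → ℂ) (ρ : ι → Matrix a a ℂ) :
    fidelity ψ (∑ κ ∈ s, ρ κ) = ∑ κ ∈ s, fidelity ψ (ρ κ) := by
  simp only [fidelity]
  rw [← Complex.re_sum]
  congr 1
  rw [Matrix.sum_mulVec, dotProduct_sum]

lemma fidelity_smul (ψ : a → ℂ) (r : ℝ) (ρ : Matrix a a ℂ) :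
    fidelity ψ (r • ρ) = r * fidelity ψ ρ := by
  rw [fidelity, fidelity, Matrix.smul_mulVec, dotProduct_smul, Complex.smul_re, smul_eq_mul]

lemma bellOf_apply {a : Type*} [Fintype a] [DecidableEq a] (A : Matrix a a ℂ) (x : a × a) :
    bellOf A x = A x.1 x.2 * ((Real.sqrt (Fintype.card a))⁻¹ : ℝ) := by
  rw [bellOf, Matrix.mulVec, dotProduct, Fintype.sum_prod_type, Finset.sum_eq_single x.2]
  · rw [Finset.sum_eq_single x.2]
    · simp [bell, Matrix.kroneckerMap_apply]
    · intro y _ hy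
      simp [bell, hy.symm]
    · simp
  · intro y _ hy
    refine Finset.sum_eq_zero fun z _ => ?_
    by_cases h : y = z
    · subst h
      simp [Matrix.kroneckerMap_apply, hy.symm]
    · simp [bell, h]
  · simp

end Fidelity

/-! ### Conditional fidelity of mixtures of coefficient vectors. -/

section Mixture

variable {G : Type*} [Group G] [TopologicalSpace G] [IsTopologicalGroup G] [CompactSpace G]
  [MeasurableSpace G] [BorelSpace G] (μ : Measure G) [μ.IsHaarMeasure] [IsProbabilityMeasure μ]
  {m n : Type*} [Fintype m] [DecidableEq m] [Fintype n] [DecidableEq n]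
  {ι : Type*} [Fintype ι]

omit [IsTopologicalGroup G] [CompactSpace G] [MeasurableSpace G] [BorelSpace G] in
lemma continuous_of_mem_coeffSpace {U : UnitaryRep G m} (hU : ContinuousEntries U) {φ : G → ℂ}
    (hφ : φ ∈ coeffSpace U) : Continuous φ := by
  obtain ⟨k, hk⟩ := mem_coeffSpace_iff.mp hφ
  rw [show φ = _ from funext hk]
  exact continuous_finsetSum _ fun p _ => continuous_finsetSum _ fun q _ =>
    continuous_const.mul (hU p q)

/-- The mixture of the pure states with (unnormalized) vectors `f κ · g`. -/
def mixture {G c : Type*} (f : ι → c → G → ℂ) (g : G) : Matrix c c ℂ :=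
  ∑ κ, ketbra fun x => f κ x g

omit [IsTopologicalGroup G] [Group G] [μ.IsHaarMeasure] [DecidableEq n] in
lemma successProb_mixture {f : ι → n → G → ℂ} (hf : ∀ κ x, Continuous (f κ x)) :
    successProb μ (mixture f) = ∑ κ, ∑ x, ∫ g, ‖f κ x g‖ ^ 2 ∂μ := by
  have hint : ∀ κ x, Integrable (fun g => ‖f κ x g‖ ^ 2) μ := fun κ x =>
    integrable_of_continuous μ ((hf κ x).norm.pow 2)
  simp only [successProb, mixture, Matrix.trace_sum, Complex.re_sum, trace_ketbra]
  rw [integral_finsetSum _ fun κ _ => integrable_finsetSum _ fun x _ => hint κ x]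
  exact Finset.sum_congr rfl fun κ _ => integral_finsetSum _ fun x _ => hint κ x

-- The weight `Tr σ_g` of the conditional distribution cancels the normalization of `σ_g`, so the
-- fidelity becomes a ratio of two integrals quadratic in `f`.
omit [IsTopologicalGroup G] [μ.IsHaarMeasure] in
lemma conditionalFidelity_mixture {V : UnitaryRep G n} (hV : ContinuousEntries V)
    {f : ι → n × n → G → ℂ} (hf : ∀ κ x, Continuous (f κ x)) :
    conditionalFidelity μ (mixture f) (fun g => bellOf (V g : Matrix n n ℂ)) =
      (successProb μ (mixture f))⁻¹ * ((Fintype.card n : ℝ)⁻¹ *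
        ∑ κ, ∫ g, ‖∑ x, star ((V g : Matrix n n ℂ) x.1 x.2) * f κ x g‖ ^ 2 ∂μ) := by
  have h1 : ∀ g, ((mixture f g).trace.re / successProb μ (mixture f)) *
      fidelity (bellOf (V g : Matrix n n ℂ)) ((((mixture f g).trace.re)⁻¹ : ℝ) • mixture f g) =
      (successProb μ (mixture f))⁻¹ * ((Fintype.card n : ℝ)⁻¹ *
        ∑ κ, ‖∑ x, star ((V g : Matrix n n ℂ) x.1 x.2) * f κ x g‖ ^ 2) := fun g => by
    have h2 : fidelity (bellOf (V g : Matrix n n ℂ)) (mixture f g) = (Fintype.card n : ℝ)⁻¹ *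
        ∑ κ, ‖∑ x, star ((V g : Matrix n n ℂ) x.1 x.2) * f κ x g‖ ^ 2 := by
      rw [mixture, fidelity_sum, Finset.mul_sum]
      refine Finset.sum_congr rfl fun κ _ => ?_
      rw [fidelity_ketbra]
      have h3 : ∑ x, star (bellOf (V g : Matrix n n ℂ) x) * f κ x g =
          ((Real.sqrt (Fintype.card n))⁻¹ : ℝ) *
            ∑ x, star ((V g : Matrix n n ℂ) x.1 x.2) * f κ x g := by
        rw [Finset.mul_sum]
        refine Finset.sum_congr rfl fun x _ => ?_
        rw [bellOf_apply, star_mul', Complex.star_def, Complex.conj_ofReal]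
        ring
      rw [h3, norm_mul, mul_pow, Complex.norm_real, Real.norm_eq_abs, sq_abs, inv_pow,
        Real.sq_sqrt (Nat.cast_nonneg _)]
    rw [fidelity_smul, ← h2]
    -- Where the trace vanishes the cancellation fails, but then every vector in the mixture is zero
    -- at `g` and both sides are `0`.
    by_cases h0 : (mixture f g).trace.re = 0
    · have h4 : mixture f g = 0 := by
        have h5 : (mixture f g).trace.re = ∑ κ, ∑ x, ‖f κ x g‖ ^ 2 := by
          simp only [mixture, Matrix.trace_sum, Complex.re_sum, trace_ketbra]
        rw [h0, eq_comm, Finset.sum_eq_zero_iff_of_nonneg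
          fun _ _ => Finset.sum_nonneg fun _ _ => sq_nonneg _] at h5
        refine Finset.sum_eq_zero fun κ hκ => ?_
        have h6 := h5 κ hκ
        rw [Finset.sum_eq_zero_iff_of_nonneg fun _ _ => sq_nonneg _] at h6
        have h7 : (fun x => f κ x g) = 0 := funext fun x => by simpa using h6 x (Finset.mem_univ _)
        rw [h7, ketbra, Matrix.zero_vecMulVec]
      rw [h4]
      simp [fidelity]
    · field_simp
  simp only [conditionalFidelity, h1]
  rw [integral_const_mul, integral_const_mul, integral_finsetSum]
  intro κ _
  exact integrable_of_continuous μ ((continuous_finsetSum _ fun x _ =>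
    (hV _ _).star.mul (hf κ x)).norm.pow 2)

/-- Numerator and denominator are both sums over the branches `κ`, so the bound for each branch
carries over to their ratio. -/
theorem conditionalFidelity_mixture_le {U : UnitaryRep G m} {V : UnitaryRep G n}
    (hU : ContinuousEntries U) (hV : ContinuousEntries V) {f : ι → n × n → G → ℂ}
    (hf : ∀ κ x, f κ x ∈ coeffSpace U) {B : ℝ} (hB0 : 0 ≤ B)
    (hB : ∀ l ∈ Irr (tensorRep V (conjRep U)), weight U V l ≤ B * l.dim)
    (hp : 0 < successProb μ (mixture f)) :
    conditionalFidelity μ (mixture f) (fun g => bellOf (V g : Matrix n n ℂ)) ≤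
      (Fintype.card n : ℝ)⁻¹ * B := by
  have hc : ∀ κ x, Continuous (f κ x) := fun κ x => continuous_of_mem_coeffSpace hU (hf κ x)
  rw [conditionalFidelity_mixture μ hV hc, inv_mul_le_iff₀ hp, mul_left_comm]
  refine mul_le_mul_of_nonneg_left ?_ (by positivity)
  rw [successProb_mixture μ hc, Finset.sum_mul]
  refine Finset.sum_le_sum fun κ _ => ?_
  rw [mul_comm _ B]
  exact integral_overlap_le μ hU hV (hf κ) hB0 hB

/-- Optimality is reached by vectors that can be rescaled at will. -/
theorem exists_conditionalFidelity_eq {U : UnitaryRep G m} {V : UnitaryRep G n}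
    (hU : ContinuousEntries U) (hV : ContinuousEntries V) {l : IrredClass G}
    (hl : l ∈ Irr (tensorRep V (conjRep U))) :
    ∃ f : n × n → G → ℂ, (∀ x, f x ∈ coeffSpace U) ∧ ∀ c : ℂ, c ≠ 0 →
      0 < successProb μ (fun g => ketbra fun x => c * f x g) ∧
      conditionalFidelity μ (fun g => ketbra fun x => c * f x g)
        (fun g => bellOf (V g : Matrix n n ℂ)) =
        1 / ((Fintype.card n : ℝ) * l.dim) * weight U V l := by
  obtain ⟨f, hf, hpos, heq⟩ := exists_integral_overlap_eq μ hU hV hl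
  refine ⟨f, hf, fun c hc => ?_⟩
  have hcont : ∀ x, Continuous (f x) := fun x => continuous_of_mem_coeffSpace hU (hf x)
  let F : Unit → n × n → G → ℂ := fun _ x g => c * f x g
  have hF : ∀ κ x, Continuous (F κ x) := fun _ x => continuous_const.mul (hcont x)
  have hmix : (fun g => ketbra fun x => c * f x g) = mixture F := by
    ext g
    simp [mixture, F]
  have hc2 : 0 < ‖c‖ ^ 2 := by positivity
  have hp : successProb μ (mixture F) = ‖c‖ ^ 2 * ∑ x, ∫ g, ‖f x g‖ ^ 2 ∂μ := by
    rw [successProb_mixture μ hF]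
    simp [F, mul_pow, integral_const_mul, Finset.mul_sum]
  have hd : (0 : ℝ) < l.dim := by exact_mod_cast l.dim_pos
  rw [hmix, conditionalFidelity_mixture μ hV hF, hp]
  refine ⟨mul_pos hc2 hpos, ?_⟩
  have h1 : ∀ g, ‖∑ x, star ((V g : Matrix n n ℂ) x.1 x.2) * F () x g‖ ^ 2 =
      ‖c‖ ^ 2 * ‖∑ x, star ((V g : Matrix n n ℂ) x.1 x.2) * f x g‖ ^ 2 := fun g => by
    rw [← mul_pow, ← norm_mul, Finset.mul_sum]
    congr 2
    exact Finset.sum_congr rfl fun x _ => by simp only [F]; ring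
  simp only [Finset.univ_unique, PUnit.default_eq_unit, Finset.sum_singleton, h1,
    integral_const_mul]
  rw [eq_div_of_mul_eq hd.ne' heq]
  field_simp

end Mixture

/-! ### Which output vectors machines and networks can produce. -/

section Machines

variable {G : Type*} [Group G]
  {m n : Type*} [Fintype m] [DecidableEq m] [Fintype n] [DecidableEq n]

lemma mulVec_mem_coeffSpace {U : UnitaryRep G m} {a b : Type*} [Fintype a]
    (K : Matrix b a ℂ) {v : G → a → ℂ} (hv : ∀ i, (fun g => v g i) ∈ coeffSpace U) (y : b) :
    (fun g => (K *ᵥ v g) y) ∈ coeffSpace U := by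
  have : (fun g => (K *ᵥ v g) y) = ∑ i, K y i • fun g => v g i := by
    ext g; simp [Matrix.mulVec, dotProduct]
  rw [this]
  exact Submodule.sum_mem _ fun i _ => Submodule.smul_mem _ _ (hv i)

lemma bellOf_mem_coeffSpace (U : UnitaryRep G m) (x : m × m) :
    (fun g => bellOf (U g : Matrix m m ℂ) x) ∈ coeffSpace U := by
  have : (fun g => bellOf (U g : Matrix m m ℂ) x) =
      ((Real.sqrt (Fintype.card m))⁻¹ : ℝ) • fun g => (U g : Matrix m m ℂ) x.1 x.2 := by
    ext g; simp [bellOf_apply, mul_comm]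
  rw [this]
  exact Submodule.smul_of_tower_mem _ _ (coeff_mem_coeffSpace U _ _)

/-- The gate acts once, on one tensor factor, so each output entry is linear in the entries of `U
g`. This is where the single use of the gate enters. -/
lemma kronecker_mulVec_mem_coeffSpace (U : UnitaryRep G m) {r s : Type*} [Fintype r]
    [DecidableEq r] [Fintype s] [DecidableEq s] (w : (m × r) × s → ℂ) (y : (m × r) × s) :
    (fun g => ((((U g : Matrix m m ℂ) ⊗ₖ (1 : Matrix r r ℂ)) ⊗ₖ (1 : Matrix s s ℂ)) *ᵥ w) y) ∈
      coeffSpace U := by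
  have : (fun g => ((((U g : Matrix m m ℂ) ⊗ₖ (1 : Matrix r r ℂ)) ⊗ₖ
      (1 : Matrix s s ℂ)) *ᵥ w) y) =
      ∑ x : (m × r) × s, ((1 : Matrix r r ℂ) y.1.2 x.1.2 * (1 : Matrix s s ℂ) y.2 x.2 * w x) •
        fun g => (U g : Matrix m m ℂ) y.1.1 x.1.1 := by
    ext g
    simp only [Matrix.mulVec, dotProduct, Finset.sum_apply, Pi.smul_apply, smul_eq_mul,
      Matrix.kroneckerMap_apply]
    exact Finset.sum_congr rfl fun x _ => by ring
  rw [this]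
  exact Submodule.sum_mem _ fun x _ => Submodule.smul_mem _ _ (coeff_mem_coeffSpace U _ _)

omit [DecidableEq n] in
/-- The outputs of a Bell state conversion are mixtures of vectors of matrix coefficients. -/
lemma exists_mixture_of_conversion (U : UnitaryRep G m)
    {M : Matrix (m × m) (m × m) ℂ →ₗ[ℂ] Matrix (n × n) (n × n) ℂ}
    (hM : IsCompletelyPositive M) :
    ∃ f : (n × n) × Fin (Fintype.card (m × m)) → n × n → G → ℂ,
      (∀ κ x, f κ x ∈ coeffSpace U) ∧
      (fun g => M (ketbra (bellOf (U g : Matrix m m ℂ)))) = mixture f := by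
  obtain ⟨K, hK⟩ := hM.exists_kraus
  refine ⟨fun κ x g => (K κ *ᵥ bellOf (U g : Matrix m m ℂ)) x, fun κ x =>
    mulVec_mem_coeffSpace (K κ) (bellOf_mem_coeffSpace U) x, ?_⟩
  ext1 g
  rw [hK]
  exact Finset.sum_congr rfl fun κ _ => mul_ketbra_mul _ _

omit [DecidableEq m] in
lemma ampliate_conjChannel (A : Matrix m m ℂ) (r : Type*) [Fintype r] [DecidableEq r]
    (X : Matrix (m × r) (m × r) ℂ) :
    ampliate (conjChannel A) r X =
      (A ⊗ₖ (1 : Matrix r r ℂ)) * X * (A ⊗ₖ (1 : Matrix r r ℂ))ᴴ := ampliate_krausMap A r X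

omit [DecidableEq m] in
lemma ampliate_ampliate_conjChannel (A : Matrix m m ℂ) (r s : Type*) [Fintype r] [DecidableEq r]
    [Fintype s] [DecidableEq s] (X : Matrix ((m × r) × s) ((m × r) × s) ℂ) :
    ampliate (ampliate (conjChannel A) r) s X =
      ((A ⊗ₖ (1 : Matrix r r ℂ)) ⊗ₖ (1 : Matrix s s ℂ)) * X *
        ((A ⊗ₖ (1 : Matrix r r ℂ)) ⊗ₖ (1 : Matrix s s ℂ))ᴴ := by
  rw [show ampliate (conjChannel A) r = krausMap (A ⊗ₖ (1 : Matrix r r ℂ)) from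
    LinearMap.ext (ampliate_conjChannel A r), ampliate_krausMap]

/-- The outputs of a network are mixtures of vectors of matrix coefficients. -/
lemma exists_mixture_of_network (U : UnitaryRep G m) {k : ℕ}
    {pre : Matrix n n ℂ →ₗ[ℂ] Matrix (m × Fin k) (m × Fin k) ℂ}
    {post : Matrix (m × Fin k) (m × Fin k) ℂ →ₗ[ℂ] Matrix n n ℂ}
    {ι κ : Type*} [Fintype ι] [Fintype κ]
    {A : ι → Matrix (m × Fin k) n ℂ} {B : κ → Matrix n (m × Fin k) ℂ}
    (hA : ∀ X, pre X = ∑ i, A i * X * (A i)ᴴ) (hB : ∀ X, post X = ∑ i, B i * X * (B i)ᴴ) :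
    ∃ f : κ × ι → n × n → G → ℂ, (∀ p x, f p x ∈ coeffSpace U) ∧
      (fun g => networkOutput (networkMap pre post (U g : Matrix m m ℂ))) = mixture f := by
  refine ⟨fun p x g => ((B p.1 ⊗ₖ (1 : Matrix n n ℂ)) *ᵥ
    ((((U g : Matrix m m ℂ) ⊗ₖ (1 : Matrix (Fin k) (Fin k) ℂ)) ⊗ₖ (1 : Matrix n n ℂ)) *ᵥ
      ((A p.2 ⊗ₖ (1 : Matrix n n ℂ)) *ᵥ bell n))) x, fun p x =>
    mulVec_mem_coeffSpace (B p.1 ⊗ₖ (1 : Matrix n n ℂ))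
      (v := fun g => (((U g : Matrix m m ℂ) ⊗ₖ (1 : Matrix (Fin k) (Fin k) ℂ)) ⊗ₖ
        (1 : Matrix n n ℂ)) *ᵥ ((A p.2 ⊗ₖ (1 : Matrix n n ℂ)) *ᵥ bell n))
      (fun i => kronecker_mulVec_mem_coeffSpace U ((A p.2 ⊗ₖ (1 : Matrix n n ℂ)) *ᵥ bell n) i) x,
    ?_⟩
  ext1 g
  rw [networkOutput, networkMap, ampliate_comp, ampliate_comp, ampliate_eq_sum hA,
    ampliate_ampliate_conjChannel, ampliate_eq_sum hB, mixture, Fintype.sum_prod_type]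
  refine Finset.sum_congr rfl fun q _ => ?_
  simp only [Matrix.mul_sum, Matrix.sum_mul]
  refine Finset.sum_congr rfl fun p _ => ?_
  rw [mul_ketbra_mul, mul_ketbra_mul, mul_ketbra_mul]

omit [DecidableEq n] in
/-- Vectors of matrix coefficients of `U` are outputs of Bell state conversions, up to scaling. -/
lemma exists_conversion [Nonempty m] (U : UnitaryRep G m) {f : n × n → G → ℂ}
    (hf : ∀ x, f x ∈ coeffSpace U) :
    ∃ M : Matrix (m × m) (m × m) ℂ →ₗ[ℂ] Matrix (n × n) (n × n) ℂ, IsQuantumOperation M ∧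
      ∃ c : ℂ, c ≠ 0 ∧ (fun g => M (ketbra (bellOf (U g : Matrix m m ℂ)))) =
        fun g => ketbra fun x => c * f x g := by
  choose K hK using fun x => mem_coeffSpace_iff.mp (hf x)
  -- The Bell vector of `U g` lists its entries up to `1/√d_in`, so one Kraus operator whose rows
  -- are the coefficients of the `f x` produces `f` up to scaling.
  obtain ⟨s, hs, hM⟩ := exists_isQuantumOperation_krausMap_smul
    (Matrix.of fun (x : n × n) (p : m × m) => K x p.1 p.2)
  refine ⟨_, hM, s * ((Real.sqrt (Fintype.card m))⁻¹ : ℝ), ?_, ?_⟩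
  · have h1 : (0 : ℝ) < Fintype.card m := by exact_mod_cast Fintype.card_pos
    rw [← Complex.ofReal_mul, Complex.ofReal_ne_zero]
    positivity
  · ext1 g
    rw [krausMap_apply, mul_ketbra_mul]
    congr 1
    ext x
    simp only [hK, Matrix.mulVec, dotProduct, Matrix.smul_apply, Matrix.of_apply, smul_eq_mul,
      bellOf_apply, Fintype.sum_prod_type, Finset.mul_sum]
    exact Finset.sum_congr rfl fun p _ => Finset.sum_congr rfl fun q _ => by ring

/-- Vectors of matrix coefficients of `U` are outputs of networks, up to scaling: the Bell state
conversion is followed by teleportation conditioned on its correction-free outcome. -/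
lemma exists_network [Nonempty n] (U : UnitaryRep G m) {f : n × n → G → ℂ}
    (hf : ∀ x, f x ∈ coeffSpace U) :
    ∃ (k : ℕ) (pre : Matrix n n ℂ →ₗ[ℂ] Matrix (m × Fin k) (m × Fin k) ℂ)
      (post : Matrix (m × Fin k) (m × Fin k) ℂ →ₗ[ℂ] Matrix n n ℂ),
      IsQuantumOperation pre ∧ IsQuantumOperation post ∧
      ∃ c : ℂ, c ≠ 0 ∧ (fun g => networkOutput (networkMap pre post (U g : Matrix m m ℂ))) =
        fun g => ketbra fun x => c * f x g := by
  choose K hK using fun x => mem_coeffSpace_iff.mp (hf x)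
  let e := Fintype.equivFin (m × n)
  -- The memory, of dimension `d_in · d_out`, encodes pairs in `m × n`: `A` sends `|w⟩` to `∑ₚ |p⟩ ⊗
  -- |(p, w)⟩`, an entangled pair for the gate together with the stored input.
  let A : Matrix (m × Fin (Fintype.card (m × n))) n ℂ := Matrix.of fun x w =>
    if x.1 = (e.symm x.2).1 ∧ (e.symm x.2).2 = w then 1 else 0
  -- The second output index of the conversion is contracted with the stored input `w`. This is the
  -- Bell projection of teleportation, and `w` is correlated with the reference system, so the
  -- reference takes over that index.
  let B : Matrix n (m × Fin (Fintype.card (m × n))) ℂ := Matrix.of fun i x =>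
    K (i, (e.symm x.2).2) x.1 (e.symm x.2).1
  obtain ⟨s, hs, hA⟩ := exists_isQuantumOperation_krausMap_smul A
  obtain ⟨t, ht, hB⟩ := exists_isQuantumOperation_krausMap_smul B
  refine ⟨_, _, _, hA, hB, t * s * ((Real.sqrt (Fintype.card n))⁻¹ : ℝ), ?_, ?_⟩
  · have h1 : (0 : ℝ) < Fintype.card n := by exact_mod_cast Fintype.card_pos
    rw [← Complex.ofReal_mul, ← Complex.ofReal_mul, Complex.ofReal_ne_zero]
    positivity
  · ext1 g
    rw [networkOutput, networkMap, ampliate_comp, ampliate_comp, ampliate_krausMap,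
      ampliate_ampliate_conjChannel, ampliate_krausMap, mul_ketbra_mul, mul_ketbra_mul,
      mul_ketbra_mul]
    congr 1
    have h1 : ∀ y, (((s : ℂ) • A) ⊗ₖ (1 : Matrix n n ℂ) *ᵥ bell n) y =
        s * ((Real.sqrt (Fintype.card n))⁻¹ : ℝ) * A y.1 y.2 := fun y => by
      rw [Matrix.mulVec, dotProduct, Fintype.sum_prod_type, Finset.sum_eq_single y.2]
      · rw [Finset.sum_eq_single y.2]
        · simp [bell, Matrix.kroneckerMap_apply]; ring
        · intro z _ hz
          simp [bell, hz.symm]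
        · simp
      · intro w _ hw
        refine Finset.sum_eq_zero fun z _ => ?_
        by_cases h : w = z
        · subst h
          simp [Matrix.kroneckerMap_apply, hw.symm]
        · simp [bell, h]
      · simp
    generalize ((s : ℂ) • A) ⊗ₖ (1 : Matrix n n ℂ) *ᵥ bell n = v at h1 ⊢
    -- After the gate, the first two registers carry the entries of `U g`, and the stored input
    -- still equals the reference index.
    have h2 : ∀ y : (m × Fin (Fintype.card (m × n))) × n,
        ((((U g : Matrix m m ℂ) ⊗ₖ (1 : Matrix (Fin (Fintype.card (m × n))) _ ℂ)) ⊗ₖ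
          (1 : Matrix n n ℂ)) *ᵥ v) y =
        s * ((Real.sqrt (Fintype.card n))⁻¹ : ℝ) * if (e.symm y.1.2).2 = y.2 then
          (U g : Matrix m m ℂ) y.1.1 (e.symm y.1.2).1 else 0 := fun y => by
      rw [Matrix.mulVec, dotProduct, Fintype.sum_prod_type, Fintype.sum_prod_type,
        Finset.sum_eq_single (e.symm y.1.2).1]
      · rw [Finset.sum_eq_single y.1.2, Finset.sum_eq_single y.2]
        · simp [h1, A, Matrix.kroneckerMap_apply]
          by_cases h : (e.symm y.1.2).2 = y.2 <;> simp [h]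
          ring
        · intro w _ hw
          simp [Matrix.kroneckerMap_apply, hw.symm]
        · simp
        · intro z _ hz
          refine Finset.sum_eq_zero fun w _ => ?_
          simp [Matrix.kroneckerMap_apply, hz.symm]
        · simp
      · intro x _ hx
        refine Finset.sum_eq_zero fun z _ => Finset.sum_eq_zero fun w _ => ?_
        by_cases hz : y.1.2 = z
        · subst hz
          simp [h1, A, hx]
        · simp [Matrix.kroneckerMap_apply, hz]
      · simp
    ext x
    rw [Matrix.mulVec, dotProduct]
    simp only [h2]
    rw [Fintype.sum_prod_type, Fintype.sum_prod_type, hK, Finset.mul_sum]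
    refine Finset.sum_congr rfl fun p _ => ?_
    rw [← e.sum_comp, Fintype.sum_prod_type, Finset.mul_sum]
    refine Finset.sum_congr rfl fun q _ => ?_
    rw [Finset.sum_eq_single x.2, Finset.sum_eq_single x.2]
    · simp [B, Matrix.kroneckerMap_apply]
      ring
    · intro w _ hw
      simp [Matrix.kroneckerMap_apply, hw.symm]
    · simp
    · intro z _ hz
      refine Finset.sum_eq_zero fun w _ => ?_
      by_cases hw : x.2 = w
      · subst hw
        simp [hz]
      · simp [Matrix.kroneckerMap_apply, hw]
    · simp

end Machines

/-! ### The case of irreducible `U`. -/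

section Irreducible

variable {G : Type*} [Group G]
  {m n : Type*} [Fintype m] [DecidableEq m] [Fintype n] [DecidableEq n]

/-- For irreducible `U` the weight is that of `U` alone. -/
lemma IsIrred.weight_eq {U : UnitaryRep G m} (hU : IsIrred U) (V : UnitaryRep G n)
    (l : IrredClass G) :
    weight U V l = Fintype.card m * multiplicity l.rep (tensorRep V (conjRep U)) := by
  obtain ⟨j, T, h1, h2, h3⟩ := hU.exists_class
  have := l.irred.nonempty
  have := j.irred.nonempty
  have hj : j ∈ Irr U := (mem_Irr_iff U).mpr ⟨T, IrredClass.ne_zero_of_isometry h1, h3⟩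
  have hIrr : (finite_Irr U).toFinset = {j} := by
    ext i
    rw [Set.Finite.mem_toFinset, Finset.mem_singleton]
    refine ⟨fun hi => ?_, fun h => h ▸ hj⟩
    obtain ⟨A, hA0, hA⟩ := (mem_Irr_iff U).mp hi
    refine IrredClass.eq_of_intertwines (h3.conjTranspose.mul hA) fun h => hA0 ?_
    rw [← Matrix.one_mul A, ← h2, Matrix.mul_assoc, h, Matrix.mul_zero]
  have hdim : j.dim = Fintype.card m := by
    have ht := congrArg Matrix.trace h2
    rw [Matrix.trace_mul_comm, h1, Matrix.trace_one, Matrix.trace_one, Fintype.card_fin] at ht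
    exact_mod_cast ht
  have h1' : (Tᴴ)ᴴ * Tᴴ = 1 := by rw [Matrix.conjTranspose_conjTranspose, h2]
  -- `U` and the representative `j` are linked by the unitary `T`; `T` and `Tᴴ` give the two
  -- inequalities.
  have hmult : multiplicity l.rep (tensorRep V (conjRep j.rep)) =
      multiplicity l.rep (tensorRep V (conjRep U)) :=
    le_antisymm
      (multiplicity_le_of_intertwines l.rep (conjTranspose_mul_one_kronecker_conj h1)
        (intertwines_one_kronecker_conj V h3))
      (multiplicity_le_of_intertwines l.rep (conjTranspose_mul_one_kronecker_conj h1')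
        (intertwines_one_kronecker_conj V h3.conjTranspose))
  rw [weight, hIrr, Finset.sum_singleton, hmult, hdim]

end Irreducible

end GateSim

/-! ### The main theorem. -/

theorem theorem4 {G : Type*} [Group G] [TopologicalSpace G] [IsTopologicalGroup G]
    [CompactSpace G] [MeasurableSpace G] [BorelSpace G]
    (μ : Measure G) [μ.IsHaarMeasure] [IsProbabilityMeasure μ]
    {m n : Type*} [Fintype m] [DecidableEq m] [Nonempty m] [Fintype n] [DecidableEq n] [Nonempty n]
    (U : GateSim.UnitaryRep G m) (V : GateSim.UnitaryRep G n)
    (hU : Continuous U) (hV : Continuous V) :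
    -- both optima are attained
    IsGreatest (GateSim.gateFidelities U V μ) (GateSim.gateFidelity U V μ) ∧
    IsGreatest (GateSim.bellFidelities U V μ) (GateSim.bellFidelity U V μ) ∧
    GateSim.gateFidelity U V μ = GateSim.bellFidelity U V μ ∧
    (GateSim.Irr U).Finite ∧
    IsGreatest
      ((fun l : GateSim.IrredClass G =>
          1 / ((Fintype.card n : ℝ) * (l.dim : ℝ)) *
            ∑ᶠ j ∈ GateSim.Irr U, (j.dim : ℝ) *
              (GateSim.multiplicity l.rep
                (GateSim.tensorRep V (GateSim.conjRep j.rep)) : ℝ)) ''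
        GateSim.Irr (GateSim.tensorRep V (GateSim.conjRep U)))
      (GateSim.bellFidelity U V μ) ∧
    (GateSim.IsIrred U →
      ∃ M : ℝ,
        IsGreatest
          ((fun l : GateSim.IrredClass G =>
              (GateSim.multiplicity l.rep
                (GateSim.tensorRep V (GateSim.conjRep U)) : ℝ) / (l.dim : ℝ)) ''
            GateSim.Irr (GateSim.tensorRep V (GateSim.conjRep U))) M ∧
        GateSim.bellFidelity U V μ = (Fintype.card m : ℝ) / (Fintype.card n : ℝ) * M) := by
  open GateSim in
  have hU' := continuousEntries_of_continuous hU
  have hV' := continuousEntries_of_continuous hV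
  have hm : (0 : ℝ) < Fintype.card m := by exact_mod_cast Fintype.card_pos
  have hn : (0 : ℝ) < Fintype.card n := by exact_mod_cast Fintype.card_pos
  have hd : ∀ l : IrredClass G, (0 : ℝ) < l.dim := fun l => by exact_mod_cast l.dim_pos
  obtain ⟨l, hl, hmax⟩ := Set.exists_max_image _ (fun l => weight U V l / (l.dim : ℝ))
    (finite_Irr (tensorRep V (conjRep U))) (Irr_nonempty _)
  -- The largest ratio of weight to dimension; the common value of both optima is `B / d_out`. The
  -- upper bounds use `hB`, while attainment uses the maximizer `l`.
  let B : ℝ := weight U V l / (l.dim : ℝ)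
  have hB0 : 0 ≤ B := div_nonneg (weight_nonneg U V l) (hd l).le
  have hB : ∀ l' ∈ Irr (tensorRep V (conjRep U)), weight U V l' ≤ B * l'.dim := fun l' hl' =>
    (div_le_iff₀ (hd l')).mp (hmax l' hl')
  have hval : 1 / ((Fintype.card n : ℝ) * l.dim) * weight U V l = (Fintype.card n : ℝ)⁻¹ * B := by
    simp only [B]
    field_simp
  obtain ⟨f, hf, hopt⟩ := exists_conditionalFidelity_eq μ hU' hV' hl
  simp_rw [hval] at hopt
  have hbell : IsGreatest (bellFidelities U V μ) ((Fintype.card n : ℝ)⁻¹ * B) := by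
    constructor
    · obtain ⟨M, hM, c, hc, heq⟩ := exists_conversion U hf
      refine ⟨M, hM, ?_, ?_⟩ <;> rw [heq]
      exacts [(hopt c hc).1, (hopt c hc).2.symm]
    · rintro _ ⟨M, hM, hp, rfl⟩
      obtain ⟨f, hf, heq⟩ := exists_mixture_of_conversion (n := n) U hM.1
      rw [heq] at hp ⊢
      exact conditionalFidelity_mixture_le μ hU' hV' hf hB0 hB hp
  have hgate : IsGreatest (gateFidelities U V μ) ((Fintype.card n : ℝ)⁻¹ * B) := by
    constructor
    · obtain ⟨k, pre, post, hpre, hpost, c, hc, heq⟩ := exists_network U hf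
      refine ⟨k, pre, post, hpre, hpost, ?_, ?_⟩ <;> rw [heq]
      exacts [(hopt c hc).1, (hopt c hc).2.symm]
    · rintro _ ⟨k, pre, post, hpre, hpost, hp, rfl⟩
      obtain ⟨A, hA⟩ := hpre.1.exists_kraus
      obtain ⟨C, hC⟩ := hpost.1.exists_kraus
      obtain ⟨f, hf, heq⟩ := exists_mixture_of_network U hA hC
      rw [heq] at hp ⊢
      exact conditionalFidelity_mixture_le μ hU' hV' hf hB0 hB hp
  have hbe : bellFidelity U V μ = (Fintype.card n : ℝ)⁻¹ * B := hbell.csSup_eq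
  have hge : gateFidelity U V μ = (Fintype.card n : ℝ)⁻¹ * B := hgate.csSup_eq
  have hweight : ∀ l : IrredClass G, ∑ᶠ j ∈ Irr U, (j.dim : ℝ) *
      (multiplicity l.rep (tensorRep V (conjRep j.rep)) : ℝ) = weight U V l := fun l =>
    finsum_mem_eq_finite_toFinset_sum _ (finite_Irr U)
  rw [hbe, hge]
  -- For irreducible `U` the weight is `d_in · m_l`, so the maximum of `m_l / d_l` is `B / d_in`.
  refine ⟨hgate, hbell, rfl, finite_Irr U, ⟨⟨l, hl, ?_⟩, ?_⟩, fun hirr => ⟨B / Fintype.card m,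
    ⟨⟨l, hl, ?_⟩, ?_⟩, ?_⟩⟩
  · simp only [hweight, hval]
  · rintro _ ⟨l', hl', rfl⟩
    have h1 := hmax l' hl'
    simp only [hweight]
    calc 1 / ((Fintype.card n : ℝ) * l'.dim) * weight U V l'
        = (Fintype.card n : ℝ)⁻¹ * (weight U V l' / l'.dim) := by
          have := (hd l').ne'
          field_simp
      _ ≤ _ := mul_le_mul_of_nonneg_left h1 (inv_nonneg.mpr hn.le)
  · simp only [B, hirr.weight_eq]
    field_simp
  · rintro _ ⟨l', hl', rfl⟩
    have h1 := hmax l' hl'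
    rw [le_div_iff₀ hm]
    refine le_trans (le_of_eq ?_) h1
    simp only [hirr.weight_eq]
    ring
  · field_simp
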